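/- **Theorem 4.4.** Let $Q$ be the quotient division ring of the first Weyl algebra $\mathbb{C}[z,\partial_z]$. For a $\mathbb{C}$-algebra $A$, a subalgebra $B\subseteq A$ is called *mad* if (i) for every $a\in A$ there is a $k\ge 0$ such that $(\operatorname{ad} b_0)(\operatorname{ad} b_1)\cdots(\operatorname{ad} b_k)(a)=0$ for all $b_0,\dots,b_k\in B$, where $(\operatorname{ad} b)(a)=ba-ab$, and (ii) the centralizer of $B$ in $A$ is $B$ itself. Let $\mathcal D\subseteq Q$ be a $\mathbb{C}$-subalgebra whose quotient division ring is $Q$ and which contains more than one mad subalgebra, and let $B$ be a mad subalgebra of $\mathcal D$. Let $(x,\partial_x)$ be a fat framing of $B$, that is, elements $x,\partial_x\in Q$ such that the integral closure of $B$ in its field of fractions $\operatorname{Frac} B\subseteq Q$ is $\mathbb{C}[x]$, and $[\partial_x,x]=1$. Then every $L\in\mathcal D$ can be written in exactly one way as a finite sum $L=\sum_i f_i\,\partial_x^i$ with $f_i\in\mathbb{C}(x)$, so that $\mathcal D\subseteq\mathbb{C}(x)[\partial_x]\subseteq Q$, and the leading coefficient of every $L\in\mathcal D$ belongs to $\mathbb{C}[x]$.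 Hence, if $\mathcal D_k$ denotes the set of elements of $\mathcal D$ of order $\le k$ in $\partial_x$ (with $\mathcal D_{-1}=0$), the symbol map, which sends the class in $\mathcal D_k/\mathcal D_{k-1}$ of an element $L=\sum_{i\le k}f_i\,\partial_x^i$ of $\mathcal D_k$ to $f_k\,\xi^k$, is a well-defined injective homomorphism that embeds the associated graded algebra $\operatorname{gr}_\partial\mathcal D=\bigoplus_{k\ge 0}\mathcal D_k/\mathcal D_{k-1}$ in $\mathbb{C}[x,\xi]$. -/

import Mathlib

open Polynomial
open scoped nonZeroDivisors DirectSum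

/-! ### The Weyl algebra and its quotient field -/

/-- Multiplication by the coordinate `z` on `ℂ[z]`. -/
noncomputable def opZ : Module.End ℂ ℂ[X] := LinearMap.mulLeft ℂ (X : ℂ[X])

/-- Differentiation `∂_z` on `ℂ[z]`. -/
noncomputable def opD : Module.End ℂ ℂ[X] := (derivative : ℂ[X] →ₗ[ℂ] ℂ[X])

/-- The (first) Weyl algebra `ℂ[z, ∂_z]`: the algebra of polynomial differential operators in one
variable, i.e. the algebra of operators on `ℂ[z]` generated over `ℂ` by `z` and `∂_z`. -/
noncomputable def weylSubalgebra : Subalgebra ℂ (Module.End ℂ ℂ[X]) :=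
  Algebra.adjoin ℂ {opZ, opD}

/-- The Weyl algebra, as a type. -/
def WeylAlgebra : Type := ↥weylSubalgebra

namespace WeylAlgebra

noncomputable instance : Ring WeylAlgebra := inferInstanceAs (Ring ↥weylSubalgebra)

noncomputable instance : Algebra ℂ WeylAlgebra := inferInstanceAs (Algebra ℂ ↥weylSubalgebra)

lemma opZ_pow_apply (i : ℕ) (f : ℂ[X]) : (opZ ^ i) f = X ^ i * f := by
  simp [opZ]

lemma opD_pow_apply (i : ℕ) (f : ℂ[X]) : (opD ^ i) f = derivative^[i] f := by
  rw [Module.End.pow_apply]; rfl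

/-- The operators of degree `≤ p` in `z` and order `≤ q`. -/
noncomputable def box (p q : ℕ) : Submodule ℂ (Module.End ℂ ℂ[X]) :=
  Submodule.span ℂ (Set.range fun ij : Fin (p + 1) × Fin (q + 1) =>
    opZ ^ (ij.1 : ℕ) * opD ^ (ij.2 : ℕ))

lemma mon_mem_box {p q i j : ℕ} (hi : i ≤ p) (hj : j ≤ q) : opZ ^ i * opD ^ j ∈ box p q :=
  Submodule.subset_span ⟨(⟨i, by omega⟩, ⟨j, by omega⟩), rfl⟩

lemma box_le {p q : ℕ} {S : Submodule ℂ (Module.End ℂ ℂ[X])}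
    (h : ∀ i j, i ≤ p → j ≤ q → opZ ^ i * opD ^ j ∈ S) : box p q ≤ S := by
  refine Submodule.span_le.2 ?_
  rintro _ ⟨⟨i, j⟩, rfl⟩
  exact h i j (by omega) (by omega)

lemma box_mono {p q p' q' : ℕ} (hp : p ≤ p') (hq : q ≤ q') : box p q ≤ box p' q' :=
  box_le fun _ _ hi hj => mon_mem_box (hi.trans hp) (hj.trans hq)

lemma opD_mul_opZ_pow (i : ℕ) :
    opD * opZ ^ i = opZ ^ i * opD + (i : ℂ) • opZ ^ (i - 1) := by
  refine LinearMap.ext fun f => ?_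
  have h1 : ∀ g, opD g = derivative g := fun _ => rfl
  simp only [Module.End.mul_apply, LinearMap.add_apply, LinearMap.smul_apply, opZ_pow_apply, h1,
    derivative_mul, derivative_X_pow, smul_eq_C_mul]
  ring

lemma opD_pow_mul_opZ (j : ℕ) :
    opD ^ j * opZ = opZ * opD ^ j + (j : ℂ) • opD ^ (j - 1) := by
  induction j with
  | zero => simp
  | succ j ih =>
    have h1 := opD_mul_opZ_pow 1
    simp only [pow_one, Nat.cast_one, one_smul, Nat.sub_self, pow_zero] at h1
    rw [pow_succ' opD j, mul_assoc, ih, mul_add, ← mul_assoc, h1]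
    rcases j with _ | j
    · simp
    · simp only [add_mul, mul_smul_comm, Nat.add_sub_cancel, ← pow_succ', one_mul]
      push_cast
      rw [add_smul (_ + _), one_smul, mul_assoc, ← pow_succ']
      abel

lemma opZ_mul_mem {p q : ℕ} {a : Module.End ℂ ℂ[X]} (ha : a ∈ box p q) :
    opZ * a ∈ box (p + 1) q := by
  refine (box_le (S := (box (p + 1) q).comap (LinearMap.mulLeft ℂ opZ)) ?_) ha
  intro i j hi hj
  simp only [Submodule.mem_comap, LinearMap.mulLeft_apply]
  rw [← mul_assoc, ← pow_succ']
  exact mon_mem_box (by omega) hj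

lemma opD_mul_mem {p q : ℕ} {a : Module.End ℂ ℂ[X]} (ha : a ∈ box p q) :
    opD * a ∈ box p (q + 1) := by
  refine (box_le (S := (box p (q + 1)).comap (LinearMap.mulLeft ℂ opD)) ?_) ha
  intro i j hi hj
  simp only [Submodule.mem_comap, LinearMap.mulLeft_apply]
  rw [← mul_assoc, opD_mul_opZ_pow, add_mul, mul_assoc, ← pow_succ', smul_mul_assoc]
  exact add_mem (mon_mem_box hi (by omega))
    (Submodule.smul_mem _ _ (mon_mem_box (by omega) (by omega)))

lemma opD_pow_mul_mem {p q : ℕ} {a : Module.End ℂ ℂ[X]} (ha : a ∈ box p q) (j : ℕ) :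
    opD ^ j * a ∈ box p (q + j) := by
  induction j with
  | zero => simpa using ha
  | succ j ih => rw [pow_succ', mul_assoc]; exact opD_mul_mem ih

lemma opZ_pow_mul_mem {p q : ℕ} {a : Module.End ℂ ℂ[X]} (ha : a ∈ box p q) (i : ℕ) :
    opZ ^ i * a ∈ box (p + i) q := by
  induction i with
  | zero => simpa using ha
  | succ i ih => rw [pow_succ', mul_assoc]; exact opZ_mul_mem ih

lemma mul_mem_box {p q p' q' : ℕ} {a b : Module.End ℂ ℂ[X]} (ha : a ∈ box p q)
    (hb : b ∈ box p' q') : a * b ∈ box (p' + p) (q' + q) := by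
  refine (box_le (S := (box (p' + p) (q' + q)).comap (LinearMap.mulRight ℂ b)) ?_) ha
  intro i j hi hj
  simp only [Submodule.mem_comap, LinearMap.mulRight_apply]
  rw [mul_assoc]
  exact box_mono (by omega) (by omega) (opZ_pow_mul_mem (opD_pow_mul_mem hb j) i)

lemma box_le_weyl (p q : ℕ) : box p q ≤ Subalgebra.toSubmodule weylSubalgebra := by
  refine box_le fun i j _ _ => ?_
  exact weylSubalgebra.mul_mem (pow_mem (Algebra.subset_adjoin (by simp)) i)
    (pow_mem (Algebra.subset_adjoin (by simp)) j)

lemma exists_mem_box {a : Module.End ℂ ℂ[X]} (ha : a ∈ weylSubalgebra) :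
    ∃ e, a ∈ box e e := by
  refine Algebra.adjoin_induction (p := fun a _ => ∃ e, a ∈ box e e) ?_ ?_ ?_ ?_ ha
  · intro x hx
    rcases hx with rfl | rfl
    · exact ⟨1, by simpa using mon_mem_box (p := 1) (q := 1) (i := 1) (j := 0) le_rfl zero_le_one⟩
    · exact ⟨1, by simpa using mon_mem_box (p := 1) (q := 1) (i := 0) (j := 1) zero_le_one le_rfl⟩
  · intro r
    refine ⟨0, ?_⟩
    rw [Algebra.algebraMap_eq_smul_one]
    exact Submodule.smul_mem _ _ (by simpa using mon_mem_box (le_refl 0) (le_refl 0))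
  · rintro x y _ _ ⟨e, he⟩ ⟨f, hf⟩
    exact ⟨e + f, add_mem (box_mono (by omega) (by omega) he) (box_mono (by omega) (by omega) hf)⟩
  · rintro x y _ _ ⟨e, he⟩ ⟨f, hf⟩
    exact ⟨f + e, mul_mem_box he hf⟩

/-- The inner derivation `a ↦ [z, a]`. -/
noncomputable def adZ : Module.End ℂ (Module.End ℂ ℂ[X]) :=
  LinearMap.mulLeft ℂ opZ - LinearMap.mulRight ℂ opZ

lemma adZ_apply (a : Module.End ℂ ℂ[X]) : adZ a = opZ * a - a * opZ := rfl

lemma adZ_mul (a b : Module.End ℂ ℂ[X]) : adZ (a * b) = adZ a * b + a * adZ b := by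
  simp only [adZ_apply, sub_mul, mul_sub, mul_assoc]
  abel

lemma adZ_iterate_mul (N : ℕ) (a b : Module.End ℂ ℂ[X]) :
    (adZ ^ N) (a * b) = ∑ ij ∈ Finset.HasAntidiagonal.antidiagonal N,
      N.choose ij.1 • ((adZ ^ ij.1) a * (adZ ^ ij.2) b) := by
  induction N with
  | zero => simp
  | succ n ih =>
    rw [Finset.sum_antidiagonal_choose_succ_nsmul
      (fun i j => (adZ ^ i) a * (adZ ^ j) b) n, pow_succ', Module.End.mul_apply, ih, map_sum]
    simp only [map_nsmul, adZ_mul, smul_add, Finset.sum_add_distrib, pow_succ',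
      Module.End.mul_apply]
    rw [add_comm]
    congr 1
    refine Finset.sum_congr rfl fun ij hij => ?_
    rw [n.choose_symm_of_eq_add (Finset.HasAntidiagonal.mem_antidiagonal.1 hij).symm]

lemma adZ_mem {p q : ℕ} {a : Module.End ℂ ℂ[X]} (ha : a ∈ box p q) :
    (adZ ^ (q + 1)) a = 0 := by
  induction q generalizing a with
  | zero =>
    refine (box_le (S := LinearMap.ker (adZ ^ (0 + 1))) ?_) ha
    intro i j _ hj
    obtain rfl : j = 0 := by omega
    rw [LinearMap.mem_ker, zero_add, pow_one, pow_zero, mul_one, adZ_apply, ← pow_succ,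
      ← pow_succ', sub_self]
  | succ q ih =>
    rw [pow_succ, Module.End.mul_apply]
    refine ih ((box_le (S := (box p q).comap adZ) ?_) ha)
    intro i j hi hj
    have : adZ (opZ ^ i * opD ^ j) = -((j : ℂ) • (opZ ^ i * opD ^ (j - 1))) := by
      rw [adZ_apply, mul_assoc, opD_pow_mul_opZ, mul_add, ← mul_assoc, ← mul_assoc,
        ← pow_succ, ← pow_succ', mul_smul_comm]
      abel
    rw [Submodule.mem_comap, this]
    exact neg_mem (Submodule.smul_mem _ _ (mon_mem_box hi (by omega)))

lemma eq_mulLeft_of_adZ_eq_zero {a : Module.End ℂ ℂ[X]} (ha : adZ a = 0) :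
    a = LinearMap.mulLeft ℂ (a 1) := by
  have hc : ∀ f, a (X * f) = X * a f := fun f => by
    have := congrArg (fun g : Module.End ℂ ℂ[X] => g f) ha
    simp only [adZ_apply, LinearMap.sub_apply, Module.End.mul_apply, opZ, LinearMap.mulLeft_apply,
      LinearMap.zero_apply] at this
    exact (sub_eq_zero.1 this).symm
  have hX : ∀ n : ℕ, a (X ^ n) = X ^ n * a 1 := fun n => by
    induction n with
    | zero => simp
    | succ n ih => rw [pow_succ', hc, ih, mul_assoc]
  ext1 n
  ext1
  simp [← X_pow_eq_monomial, hX, mul_comm]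

lemma exists_last {a : Module.End ℂ ℂ[X]} (ha : a ∈ weylSubalgebra) (h0 : a ≠ 0) :
    ∃ n, (adZ ^ n) a ≠ 0 ∧ ∀ k, n < k → (adZ ^ k) a = 0 := by
  classical
  obtain ⟨e, he⟩ := exists_mem_box ha
  have hex : ∃ n, (adZ ^ (n + 1)) a = 0 := ⟨e, adZ_mem he⟩
  refine ⟨Nat.find hex, ?_, ?_⟩
  · rcases hn : Nat.find hex with _ | m
    · simpa using h0
    · exact Nat.find_min hex (m := m) (by omega)
  · intro k hk
    obtain ⟨d, rfl⟩ := Nat.exists_eq_add_of_lt hk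
    rw [show Nat.find hex + d + 1 = d + (Nat.find hex + 1) by omega, pow_add,
      Module.End.mul_apply, Nat.find_spec hex, map_zero]

lemma mul_ne_zero_of_mem {a b : Module.End ℂ ℂ[X]} (ha : a ∈ weylSubalgebra)
    (hb : b ∈ weylSubalgebra) (ha0 : a ≠ 0) (hb0 : b ≠ 0) : a * b ≠ 0 := by
  obtain ⟨n, hn, hn'⟩ := exists_last ha ha0
  obtain ⟨m, hm, hm'⟩ := exists_last hb hb0
  intro hab
  have key := adZ_iterate_mul (n + m) a b
  rw [hab, map_zero, Finset.sum_eq_single (n, m)] at key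
  · have hz : (adZ ^ n) a * (adZ ^ m) b = 0 := by
      rcases smul_eq_zero.1 key.symm with h | h
      · exact absurd h (Nat.choose_pos (by omega)).ne'
      · exact h
    have h1 := eq_mulLeft_of_adZ_eq_zero (a := (adZ ^ n) a) (by
      rw [← Module.End.mul_apply, ← pow_succ']; exact hn' _ (by omega))
    have h2 := eq_mulLeft_of_adZ_eq_zero (a := (adZ ^ m) b) (by
      rw [← Module.End.mul_apply, ← pow_succ']; exact hm' _ (by omega))
    have h3 := congrArg (fun g : Module.End ℂ ℂ[X] => g 1) hz
    simp only [Module.End.mul_apply, LinearMap.zero_apply] at h3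
    rw [h1, LinearMap.mulLeft_apply] at h3
    rcases mul_eq_zero.1 h3 with h | h
    · exact hn (by rw [h1, h]; simp)
    · exact hm (by rw [h2, h]; simp)
  · rintro ⟨i, j⟩ hij hne
    rw [Finset.HasAntidiagonal.mem_antidiagonal] at hij
    simp only at hij
    rcases lt_trichotomy n i with h | h | h
    · simp [hn' i h]
    · exact absurd (by ext <;> simp <;> omega) hne
    · simp [hm' j (by omega)]
  · intro h; simp at h

instance : Nontrivial WeylAlgebra := inferInstanceAs (Nontrivial ↥weylSubalgebra)

instance : NoZeroDivisors WeylAlgebra where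
  eq_zero_or_eq_zero_of_mul_eq_zero {a b} h := by
    by_contra! hc
    exact mul_ne_zero_of_mem a.2 b.2 (fun h => hc.1 (Subtype.ext h))
      (fun h => hc.2 (Subtype.ext h)) (congrArg Subtype.val h)

/-- The operator `∑ cᵢⱼ zⁱ ∂_zʲ` with `i, j ≤ n`. -/
noncomputable def ofCoeffs (n : ℕ) :
    (Fin (n + 1) × Fin (n + 1) → ℂ) →ₗ[ℂ] Module.End ℂ ℂ[X] :=
  Fintype.linearCombination ℂ fun ij => opZ ^ (ij.1 : ℕ) * opD ^ (ij.2 : ℕ)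

lemma ofCoeffs_mem (n : ℕ) (c : Fin (n + 1) × Fin (n + 1) → ℂ) : ofCoeffs n c ∈ box n n := by
  rw [ofCoeffs, Fintype.linearCombination_apply]
  exact sum_mem fun ij _ => Submodule.smul_mem _ _ (mon_mem_box (by omega) (by omega))

lemma ofCoeffs_eq_zero (n : ℕ) (c : Fin (n + 1) × Fin (n + 1) → ℂ) (h : ofCoeffs n c = 0) :
    c = 0 := by
  have key : ∀ (j : ℕ) (hj : j < n + 1) (i : Fin (n + 1)), c (i, ⟨j, hj⟩) = 0 := by
    intro j
    induction j using Nat.strong_induction_on with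
    | _ j ih =>
      intro hj i
      have h1 := congrArg (fun g : Module.End ℂ ℂ[X] => (g (X ^ j)).coeff (i : ℕ)) h
      simp only [ofCoeffs, Fintype.linearCombination_apply, LinearMap.sum_apply,
        LinearMap.smul_apply, Module.End.mul_apply, opZ_pow_apply,
        LinearMap.zero_apply, Polynomial.finsetSum_coeff,
        Polynomial.coeff_smul, Polynomial.coeff_zero] at h1
      rw [Finset.sum_eq_single (i, ⟨j, hj⟩)] at h1
      · have h2 : ((opD ^ j) (X ^ j : ℂ[X])) = (j.factorial : ℂ[X]) := by
          rw [opD_pow_apply]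
          exact Polynomial.iterate_derivative_X_pow_eq_natCast_mul j j |>.trans (by simp [Nat.descFactorial_self])
        simp only [h2, Polynomial.coeff_mul_natCast, Polynomial.coeff_X_pow, if_true,
          smul_eq_mul, one_mul] at h1
        exact (mul_eq_zero.1 h1).resolve_right (by exact_mod_cast j.factorial_ne_zero)
      · rintro ⟨i', j'⟩ _ hne
        rcases lt_trichotomy (j' : ℕ) j with h' | h' | h'
        · rw [ih j' h' j'.2 i']; simp
        · have h2 : ((opD ^ (j' : ℕ)) (X ^ j : ℂ[X])) = (j.factorial : ℂ[X]) := by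
            rw [opD_pow_apply, h']
            exact Polynomial.iterate_derivative_X_pow_eq_natCast_mul j j |>.trans (by simp [Nat.descFactorial_self])
          have : (i : ℕ) ≠ i' := fun hi => hne (by ext <;> simp [hi, h'])
          simp [h2, Polynomial.coeff_mul_natCast, Polynomial.coeff_X_pow, this]
        · have h2 : ((opD ^ (j' : ℕ)) (X ^ j : ℂ[X])) = 0 := by
            rw [opD_pow_apply]
            exact Polynomial.iterate_derivative_eq_zero (by simpa using h')
          simp [h2]
      · simp
  funext ⟨i, j⟩
  exact key j j.2 i

lemma exists_coeffs {e n : ℕ} (hn : (e + n + 1) * (e + n + 1) < 2 * ((n + 1) * (n + 1)))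
    {a b : Module.End ℂ ℂ[X]} (ha : a ∈ box e e) (hb : b ∈ box e e) :
    ∃ c d : Fin (n + 1) × Fin (n + 1) → ℂ,
      (c ≠ 0 ∨ d ≠ 0) ∧ ofCoeffs n c * a = ofCoeffs n d * b := by
  by_contra! hcon
  let I := Fin (n + 1) × Fin (n + 1) → ℂ
  let Φ₀ : (I × I) →ₗ[ℂ] Module.End ℂ ℂ[X] :=
    (LinearMap.mulRight ℂ a ∘ₗ ofCoeffs n).coprod (-(LinearMap.mulRight ℂ b ∘ₗ ofCoeffs n))
  have hval : ∀ c d, Φ₀ (c, d) = ofCoeffs n c * a - ofCoeffs n d * b := fun c d => by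
    simp [Φ₀, sub_eq_add_neg]
  have hΦ₀ : ∀ cd, Φ₀ cd ∈ box (e + n) (e + n) := fun ⟨c, d⟩ => by
    rw [hval]
    exact sub_mem (mul_mem_box (ofCoeffs_mem n c) ha) (mul_mem_box (ofCoeffs_mem n d) hb)
  have hfin : Module.Finite ℂ (box (e + n) (e + n)) :=
    Module.Finite.span_of_finite ℂ (Set.finite_range _)
  have hrank : Module.finrank ℂ (box (e + n) (e + n)) ≤ (e + n + 1) * (e + n + 1) := by
    refine (finrank_range_le_card _).trans ?_
    simp
  have hinj : Function.Injective (Φ₀.codRestrict _ hΦ₀) := by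
    refine (injective_iff_map_eq_zero _).2 ?_
    rintro ⟨c, d⟩ hcd
    have h0 : Φ₀ (c, d) = 0 := congrArg Subtype.val hcd
    rw [hval, sub_eq_zero] at h0
    by_cases hc : c = 0
    · by_cases hd : d = 0
      · rw [hc, hd]; rfl
      · exact absurd h0 (hcon c d (Or.inr hd))
    · exact absurd h0 (hcon c d (Or.inl hc))
  have h1 := LinearMap.finrank_le_finrank_of_injective hinj
  simp only [I, Module.finrank_prod, Module.finrank_fintype_fun_eq_card, Fintype.card_prod,
    Fintype.card_fin] at h1
  have h2 := h1.trans hrank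
  omega

lemma exists_ore (a b : WeylAlgebra) (ha : a ≠ 0) :
    ∃ u v : WeylAlgebra, v ≠ 0 ∧ v * b = u * a := by
  obtain ⟨e₁, he₁⟩ := exists_mem_box a.2
  obtain ⟨e₂, he₂⟩ := exists_mem_box b.2
  obtain ⟨c, d, hne, heq⟩ := exists_coeffs (e := e₁ + e₂) (n := 3 * (e₁ + e₂))
    (by nlinarith) (box_mono (by omega) (by omega) he₁) (box_mono (by omega) (by omega) he₂)
  refine ⟨⟨ofCoeffs _ c, box_le_weyl _ _ (ofCoeffs_mem _ c)⟩,
    ⟨ofCoeffs _ d, box_le_weyl _ _ (ofCoeffs_mem _ d)⟩, ?_, Subtype.ext heq.symm⟩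
  intro hv
  have hd : ofCoeffs _ d = 0 := congrArg Subtype.val hv
  rw [hd, zero_mul] at heq
  have hc : ofCoeffs _ c = 0 := by
    by_contra hc
    exact mul_ne_zero_of_mem (box_le_weyl _ _ (ofCoeffs_mem _ c)) a.2 hc
      (fun h => ha (Subtype.ext h)) heq
  rcases hne with h | h
  · exact h (ofCoeffs_eq_zero _ c hc)
  · exact h (ofCoeffs_eq_zero _ d hd)

/-- The nonzero elements of the Weyl algebra form an Ore set. -/
noncomputable instance : OreLocalization.OreSet (nonZeroDivisors WeylAlgebra) :=
  Classical.choice <| (OreLocalization.nonempty_oreSet_iff_of_noZeroDivisors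
    (R := WeylAlgebra) (S := nonZeroDivisors WeylAlgebra)).2 fun r s => by
    obtain ⟨u, v, hv, h⟩ := exists_ore (s : WeylAlgebra) r (nonZeroDivisors.ne_zero s.2)
    exact ⟨u, ⟨v, mem_nonZeroDivisors_of_ne_zero hv⟩, h⟩

end WeylAlgebra

/-- The quotient field of the Weyl algebra: its division ring of fractions `s⁻¹ r`, `s ≠ 0`. -/
def WeylField : Type := OreLocalization (nonZeroDivisors WeylAlgebra) WeylAlgebra

noncomputable instance : DivisionRing WeylField :=
  inferInstanceAs (DivisionRing (OreLocalization (nonZeroDivisors WeylAlgebra) WeylAlgebra))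

noncomputable instance : Algebra ℂ WeylField :=
  inferInstanceAs (Algebra ℂ (OreLocalization (nonZeroDivisors WeylAlgebra) WeylAlgebra))

/-! ### Mad subalgebras -/

section Mad

variable {A : Type*} [Ring A] [Algebra ℂ A]

/-- `N_k(B)`: the elements `a` with `(ad b₀) (ad b₁) ⋯ (ad b_k) a = 0` for all
`b₀, …, b_k ∈ B`. -/
def adKernel (B : Subalgebra ℂ A) (k : ℕ) : Set A :=
  {a | ∀ l : List A, l.length = k + 1 → (∀ b ∈ l, b ∈ B) → l.foldr (fun b c => ⁅b, c⁆) a = 0}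

/-- `B` is a mad subalgebra of `A`: it is ad-nilpotent, that is `⋃ₖ N_k(B) = A`, and it is its own
centralizer in `A`. -/
structure IsMad (B : Subalgebra ℂ A) : Prop where
  adNilpotent : ⋃ k, adKernel B k = Set.univ
  centralizer_eq : Subalgebra.centralizer ℂ (B : Set A) = B

end Mad

/-! ### Subalgebras of a division ring, framings -/

section Framing

variable {Q : Type*} [DivisionRing Q] [Algebra ℂ Q]

/-- `Q` is the quotient field of its subalgebra `D`: every element of `Q` is a fraction `L₂ L₁⁻¹`
of elements of `D`. -/
def IsQuotientFieldOf (D : Subalgebra ℂ Q) : Prop :=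
  ∀ f : Q, ∃ L₁ ∈ D, ∃ L₂ ∈ D, L₁ ≠ 0 ∧ f = L₂ * L₁⁻¹

/-- The field of fractions `Frac B` of a (commutative) subalgebra `B` of `Q`, inside `Q`. -/
def fracField (B : Subalgebra ℂ Q) : Subfield Q := Subfield.closure (B : Set Q)

/-- The integral closure of a (commutative) subalgebra `B` of `Q` in its field of fractions:
the elements of `Frac B` that are roots of a monic polynomial with coefficients in `B`. -/
def integralClosureInFrac (B : Subalgebra ℂ Q) : Set Q :=
  {f | f ∈ fracField B ∧ ∃ p : Q[X], p.Monic ∧ (∀ i, p.coeff i ∈ B) ∧ p.eval f = 0}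

/-- The subalgebra `ℂ[x]` of `Q`. -/
abbrev polyRing (x : Q) : Subalgebra ℂ Q := Algebra.adjoin ℂ {x}

/-- The subfield `ℂ(x)` of `Q`. -/
abbrev ratField (x : Q) : Subfield Q := fracField (polyRing x)

/-- `(x, ∂)` is a fat framing of `B`: the integral closure of `B` is `ℂ[x]`, and `[∂, x] = 1`. -/
structure IsFatFraming (B : Subalgebra ℂ Q) (x d : Q) : Prop where
  integralClosure_eq : integralClosureInFrac B = (polyRing x : Set Q)
  bracket_eq : ⁅d, x⁆ = 1

/-! ### Differential operators with coefficients in `ℂ(x)` -/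

/-- The element `∑ fᵢ ∂ⁱ` of `ℂ(x)[∂] ⊆ Q`, where `fᵢ ∈ ℂ(x)` is the `i`-th coefficient of `f`.
Thus, when `f` is uniquely determined by the operator, `f.leadingCoeff` is the leading coefficient
of the operator and `f.natDegree` its order. -/
noncomputable def diffOp (x d : Q) (f : (ratField x)[X]) : Q :=
  f.sum fun i c => (c : Q) * d ^ i

lemma diffOp_add (x d : Q) (f g : (ratField x)[X]) :
    diffOp x d (f + g) = diffOp x d f + diffOp x d g :=
  Polynomial.sum_add_index _ _ _ (by simp) (by simp [add_mul])

lemma algebraMap_mem_ratField (x : Q) (c : ℂ) : algebraMap ℂ Q c ∈ ratField x :=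
  Subfield.subset_closure (Subalgebra.algebraMap_mem _ c)

lemma diffOp_C_mul (x d : Q) (c : ℂ) (f : (ratField x)[X]) :
    diffOp x d (C ⟨algebraMap ℂ Q c, algebraMap_mem_ratField x c⟩ * f) = c • diffOp x d f := by
  induction f using Polynomial.induction_on' with
  | add f g hf hg => rw [mul_add, diffOp_add, diffOp_add, hf, hg, smul_add]
  | monomial n a =>
    rw [C_mul_monomial]
    simp [diffOp, Polynomial.sum_monomial_index, Algebra.smul_def, mul_assoc]

/-- The elements of `D` that are operators `∑ fᵢ ∂ⁱ` over `ℂ(x)` of order `< n`. In the notation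
`D_k` for the elements of order `≤ k` (so `D_{-1} = 0`), this is `D_{n - 1}`. -/
noncomputable def orderLT (D : Subalgebra ℂ Q) (x d : Q) (n : ℕ) : Submodule ℂ Q where
  carrier := {L | L ∈ D ∧ ∃ f : (ratField x)[X], f.degree < n ∧ diffOp x d f = L}
  zero_mem' := ⟨D.zero_mem, 0, by simp, by simp [diffOp]⟩
  add_mem' := by
    rintro _ _ ⟨h₁, f, hf, rfl⟩ ⟨h₂, g, hg, rfl⟩
    exact ⟨D.add_mem h₁ h₂, f + g, (degree_add_le f g).trans_lt (max_lt hf hg), diffOp_add x d f g⟩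
  smul_mem' := by
    rintro c _ ⟨h, f, hf, rfl⟩
    refine ⟨D.smul_mem h c, _, ?_, diffOp_C_mul x d c f⟩
    refine (degree_mul_le _ _).trans_lt (lt_of_le_of_lt ?_ hf)
    simpa using add_le_add_left (degree_C_le (R := ratField x)) f.degree

/-- The associated graded space `gr_∂ D = ⨁ₖ D_k / D_{k-1}` of the filtration by order. -/
abbrev GrOrder (D : Subalgebra ℂ Q) (x d : Q) : Type _ :=
  ⨁ k : ℕ, (↥(orderLT D x d (k + 1)) ⧸
    (orderLT D x d k).submoduleOf (orderLT D x d (k + 1)))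

/-- The class in the `k`-th component `D_k / D_{k-1}` of `gr_∂ D` of an element of `D_k`. -/
noncomputable def grClass (D : Subalgebra ℂ Q) (x d : Q) (k : ℕ)
    (L : orderLT D x d (k + 1)) : GrOrder D x d :=
  DirectSum.lof ℂ ℕ (fun k : ℕ => ↥(orderLT D x d (k + 1)) ⧸
    (orderLT D x d k).submoduleOf (orderLT D x d (k + 1))) k (Submodule.Quotient.mk L)

end Framing

/-! Write `F` for `ℂ(x)`, `f'` for `[d, f]`, and "symbol" for the leading term of an operator. The
argument works in any division ring over `ℂ`.

Finite order. Argue by induction along the nilpotent action of `B`: suppose that all `[b, L]` with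
`b ∈ B` lie in `F[d]`. The elements of `F` whose commutator with `L` lies in `F[d]` form a field, so
`[x, L]` lies there too. Bracketing with `x` is differentiation with respect to `d`, so in
characteristic zero `[x, L]` can be integrated: some `R` in `F[d]` makes `L + R` commute with `x`,
hence with `B`. The centralizer of `B` in the quotient field is `Frac B = F`
(`IsMad.mem_fracField_of_forall_commute`), so `L` lies in `F[d]`. The same differentiation proves
that expansions are unique (`eval₂_injective`).

Polynomial leading coefficients. It suffices to bound orders of vanishing below by `0` at each point
`a`. A second mad subalgebra `B'` contains some `b` outside `F`; let `m > 0` be its order and `s`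
the order at `a` of its leading coefficient `g`. If `L` has order `n` and leading coefficient `f`
with order `r` at `a`, then `[b, L]` has the coefficient `m g f' - n f g'` in degree `n + m - 1`.
When the weight `m r - n s` is nonzero, this coefficient has order exactly `r + s - 1` at `a`, and
the weight drops by `m - s`. Nilpotency forces the weight to reach zero, so `m r - n s = j (m - s)`
with `j ≥ 0` (`IsMad.exists_weight_eq`). An element of `B` vanishing at `a` shows `s < m`; writing
`x - a` as a fraction of elements of `D` shows `m - s ∣ m`, hence `s ≥ 0`. Therefore `m r = n s + j
(m - s) ≥ 0`.

Symbols multiply because moving `d` past a coefficient only adds terms of lower order, so top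
coefficients give the embedding of the graded algebra. -/

/-! ### Subfields of a division ring cut out by commutators -/

section Commutators

variable {Q : Type*} [DivisionRing Q]

/-- The centralizer of a set, as a subfield of a division ring. -/
def centralizerSubfield (S : Set Q) : Subfield Q where
  toSubring := Subring.centralizer S
  inv_mem' _ h := Set.inv_mem_centralizer₀ h

lemma mem_centralizerSubfield {S : Set Q} {a : Q} :
    a ∈ centralizerSubfield S ↔ ∀ s ∈ S, s * a = a * s := Subring.mem_centralizer_iff

/-- The elements of a subfield `K` whose commutator with `L` lies in a `K`-bimodule `R`. -/
def commutatorSubfield (K : Subfield Q) (R : AddSubgroup Q) (hl : ∀ k ∈ K, ∀ r ∈ R, k * r ∈ R)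
    (hr : ∀ k ∈ K, ∀ r ∈ R, r * k ∈ R) (L : Q) : Subfield Q where
  carrier := {c | c ∈ K ∧ c * L - L * c ∈ R}
  zero_mem' := ⟨K.zero_mem, by simp⟩
  one_mem' := ⟨K.one_mem, by simp⟩
  add_mem' := by
    rintro a b ⟨ha, ha'⟩ ⟨hb, hb'⟩
    refine ⟨K.add_mem ha hb, ?_⟩
    convert R.add_mem ha' hb' using 1
    noncomm_ring
  neg_mem' := by
    rintro a ⟨ha, ha'⟩
    refine ⟨K.neg_mem ha, ?_⟩
    convert R.neg_mem ha' using 1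
    noncomm_ring
  mul_mem' := by
    rintro a b ⟨ha, ha'⟩ ⟨hb, hb'⟩
    refine ⟨K.mul_mem ha hb, ?_⟩
    convert R.add_mem (hl a ha _ hb') (hr b hb _ ha') using 1
    noncomm_ring
  inv_mem' := by
    rintro a ⟨ha, ha'⟩
    refine ⟨K.inv_mem ha, ?_⟩
    rcases eq_or_ne a 0 with rfl | h0
    · simp
    -- This is `[a⁻¹, L] = -a⁻¹ [a, L] a⁻¹`.
    convert R.neg_mem (hl _ (K.inv_mem ha) _ (hr _ (K.inv_mem ha) _ ha')) using 1
    rw [sub_mul, mul_assoc a, mul_assoc L, mul_inv_cancel₀ h0, mul_sub, ← mul_assoc, ← mul_assoc,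
      ← mul_assoc, inv_mul_cancel₀ h0]
    noncomm_ring

/-- The elements of the subfield generated by a set `S` have their commutator with `L` in a
bimodule `R` as soon as those of `S` do. -/
lemma commutator_mem_of_mem_closure {S : Set Q} (R : AddSubgroup Q)
    (hl : ∀ k ∈ Subfield.closure S, ∀ r ∈ R, k * r ∈ R)
    (hr : ∀ k ∈ Subfield.closure S, ∀ r ∈ R, r * k ∈ R) {L : Q}
    (hS : ∀ c ∈ S, c * L - L * c ∈ R) {c : Q} (hc : c ∈ Subfield.closure S) :
    c * L - L * c ∈ R :=
  ((Subfield.closure_le (t := commutatorSubfield _ R hl hr L)).2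
    (fun c hc => ⟨Subfield.subset_closure hc, hS c hc⟩) hc).2

end Commutators

/-! ### Differential operators with coefficients in a differential field -/

section Operators

variable {Q F : Type*} [DivisionRing Q] [Field F]

/-- The operators of order `< n`: the additive group spanned by the `f dⁱ` with `i < n`. -/
def opsLT (φ : F →+* Q) (d : Q) (n : ℤ) : AddSubgroup Q :=
  AddSubgroup.closure {y | ∃ (f : F) (i : ℕ), (i : ℤ) < n ∧ y = φ f * d ^ i}

variable {φ : F →+* Q} {δ : Derivation ℤ F F} {d : Q}

lemma mul_pow_mem_opsLT {n : ℤ} (f : F) {i : ℕ} (h : (i : ℤ) < n) :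
    φ f * d ^ i ∈ opsLT φ d n := AddSubgroup.subset_closure ⟨f, i, h, rfl⟩

lemma opsLT_le {n : ℤ} {R : AddSubgroup Q} (h : ∀ (f : F) (i : ℕ), (i : ℤ) < n → φ f * d ^ i ∈ R) :
    opsLT φ d n ≤ R := by
  refine (AddSubgroup.closure_le _).2 ?_
  rintro _ ⟨f, i, hi, rfl⟩
  exact h f i hi

lemma opsLT_mono {m n : ℤ} (h : m ≤ n) : opsLT φ d m ≤ opsLT φ d n :=
  opsLT_le fun f _ hi => mul_pow_mem_opsLT f (hi.trans_le h)

lemma coeff_mul_mem_opsLT {n : ℤ} (g : F) {L : Q} (hL : L ∈ opsLT φ d n) :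
    φ g * L ∈ opsLT φ d n := by
  refine opsLT_le (R := (opsLT φ d n).comap (AddMonoidHom.mulLeft (φ g))) (fun f i hi => ?_) hL
  simp only [AddSubgroup.mem_comap, AddMonoidHom.coe_mulLeft, ← mul_assoc, ← map_mul]
  exact mul_pow_mem_opsLT _ hi

lemma mul_pow_mem_opsLT_add {n : ℤ} {L : Q} (hL : L ∈ opsLT φ d n) (j : ℕ) :
    L * d ^ j ∈ opsLT φ d (n + j) := by
  refine opsLT_le (R := (opsLT φ d (n + j)).comap (AddMonoidHom.mulRight (d ^ j)))
    (fun f i hi => ?_) hL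
  simp only [AddSubgroup.mem_comap, AddMonoidHom.mulRight_apply, mul_assoc, ← pow_add]
  exact mul_pow_mem_opsLT _ (by push_cast; omega)

/-! ### Moving `d` past coefficients: products and commutators -/

section

variable (hd : ∀ f, d * φ f = φ f * d + φ (δ f))
include hd

lemma d_mul_mem_opsLT {n : ℤ} {L : Q} (hL : L ∈ opsLT φ d n) : d * L ∈ opsLT φ d (n + 1) := by
  refine opsLT_le (R := (opsLT φ d (n + 1)).comap (AddMonoidHom.mulLeft d)) (fun f i hi => ?_) hL
  simp only [AddSubgroup.mem_comap, AddMonoidHom.coe_mulLeft, ← mul_assoc, hd, add_mul]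
  rw [mul_assoc, ← pow_succ']
  exact add_mem (mul_pow_mem_opsLT _ (by push_cast; omega)) (mul_pow_mem_opsLT _ (by omega))

/-- The Leibniz rule to second order: the top terms cancel in commutators, so the next one is
needed. The bounds are integers and may be negative; the exponent `i - 1` truncates at `i = 0`,
harmlessly, as its coefficient is then zero. -/
lemma d_pow_mul_sub_mem_opsLT (i : ℕ) (g : F) :
    d ^ i * φ g - φ g * d ^ i - φ (i * δ g) * d ^ (i - 1) ∈ opsLT φ d (i - 1) := by
  induction i with
  | zero => simp
  | succ i ih =>
    have h := d_mul_mem_opsLT hd ih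
    have h1 : φ (i * δ (δ g)) * d ^ (i - 1) ∈ opsLT φ d i := by
      rcases i with _ | i
      · simp
      · exact mul_pow_mem_opsLT _ (by push_cast; omega)
    have h2 : φ (i * δ g) * (d * d ^ (i - 1)) = φ (i * δ g) * d ^ i := by
      rcases i with _ | i
      · simp
      · rw [← pow_succ']; simp
    push_cast at h ⊢
    rw [sub_add_cancel] at h
    rw [add_sub_cancel_right]
    convert add_mem h h1 using 1
    have h3 : d * (φ (i * δ g)) = φ (i * δ g) * d + φ (i * δ (δ g)) := by
      rw [hd]; congr 2; simp
    rw [mul_sub, mul_sub, ← mul_assoc d (φ g), hd, ← mul_assoc d (φ (i * δ g)), h3, add_mul,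
      add_mul (φ (i * δ g) * d), mul_assoc (φ (i * δ g)), h2, pow_succ', mul_assoc]
    simp only [map_add, one_mul, add_mul, mul_assoc]
    abel

lemma d_pow_mul_mem_opsLT (i : ℕ) (g : F) : d ^ i * φ g ∈ opsLT φ d (i + 1) := by
  have h1 := opsLT_mono (n := (i : ℤ) + 1) (by omega) (d_pow_mul_sub_mem_opsLT hd i g)
  have h2 : φ g * d ^ i ∈ opsLT φ d (i + 1) := mul_pow_mem_opsLT _ (by omega)
  have h3 : φ (i * δ g) * d ^ (i - 1) ∈ opsLT φ d (i + 1) := mul_pow_mem_opsLT _ (by omega)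
  convert add_mem (add_mem h1 h3) h2 using 1
  abel

lemma d_pow_mul_sub_mem_opsLT' (i : ℕ) (g : F) : d ^ i * φ g - φ g * d ^ i ∈ opsLT φ d i := by
  have h1 := opsLT_mono (n := (i : ℤ)) (by omega) (d_pow_mul_sub_mem_opsLT hd i g)
  have h3 : φ (i * δ g) * d ^ (i - 1) ∈ opsLT φ d i := by
    rcases i with _ | i
    · simp
    · exact mul_pow_mem_opsLT _ (by push_cast; omega)
  convert add_mem h1 h3 using 1
  abel

lemma mul_mem_opsLT {a b : ℤ} {L M : Q} (hL : L ∈ opsLT φ d a) (hM : M ∈ opsLT φ d b) :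
    L * M ∈ opsLT φ d (a + b - 1) := by
  refine opsLT_le (R := (opsLT φ d (a + b - 1)).comap (AddMonoidHom.mulRight M))
    (fun f i hi => ?_) hL
  refine opsLT_le (R := (opsLT φ d (a + b - 1)).comap (AddMonoidHom.mulLeft (φ f * d ^ i)))
    (fun g j hj => ?_) hM
  simp only [AddSubgroup.mem_comap, AddMonoidHom.coe_mulLeft]
  rw [mul_assoc, ← mul_assoc (d ^ i)]
  exact coeff_mul_mem_opsLT _ (opsLT_mono (by omega)
    (mul_pow_mem_opsLT_add (d_pow_mul_mem_opsLT hd i g) j))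

lemma monomial_mul_sub_mem_opsLT (f g : F) (i j : ℕ) :
    φ f * d ^ i * (φ g * d ^ j) - φ (f * g) * d ^ (i + j) - φ (i * (f * δ g)) * d ^ (i + j - 1)
      ∈ opsLT φ d (i + j - 1) := by
  have h := coeff_mul_mem_opsLT f (mul_pow_mem_opsLT_add (d_pow_mul_sub_mem_opsLT hd i g) j)
  convert opsLT_mono (show (i : ℤ) - 1 + j ≤ i + j - 1 by omega) h using 1
  have h2 : φ (i * (f * δ g)) * d ^ (i + j - 1) = φ f * (φ (i * δ g) * d ^ (i - 1) * d ^ j) := by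
    rcases i with _ | i
    · simp
    · rw [mul_assoc (φ _), ← pow_add, ← mul_assoc (φ f), ← map_mul]
      congr 2
      · ring
      · omega
  rw [h2, sub_mul, sub_mul, mul_sub, mul_sub, map_mul, pow_add]
  simp only [mul_assoc]

/-- Since `F` is commutative the terms `f g d ^ (i + j)` cancel. What remains in the next degree is
the Poisson bracket of the two symbols. -/
lemma monomial_commutator_sub_mem_opsLT (f g : F) (i j : ℕ) :
    φ f * d ^ i * (φ g * d ^ j) - φ g * d ^ j * (φ f * d ^ i)
      - φ (i * (f * δ g) - j * (g * δ f)) * d ^ (i + j - 1) ∈ opsLT φ d (i + j - 1) := by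
  have h1 := monomial_mul_sub_mem_opsLT hd f g i j
  have h2 := monomial_mul_sub_mem_opsLT hd g f j i
  rw [add_comm j i, add_comm (j : ℤ) i, mul_comm g f] at h2
  convert sub_mem h1 h2 using 1
  rw [map_sub, sub_mul]
  abel

/-- The bounds are strict: orders at most `a - 1` and `b - 1` give a product of order at most `a + b
- 2`, and the commutator loses one more. -/
lemma commutator_mem_opsLT {a b : ℤ} {L M : Q} (hL : L ∈ opsLT φ d a) (hM : M ∈ opsLT φ d b) :
    L * M - M * L ∈ opsLT φ d (a + b - 2) := by
  refine opsLT_le (R := (opsLT φ d (a + b - 2)).comap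
    (AddMonoidHom.mulRight M - AddMonoidHom.mulLeft M)) (fun f i hi => ?_) hL
  refine opsLT_le (R := (opsLT φ d (a + b - 2)).comap
    (AddMonoidHom.mulLeft (φ f * d ^ i) - AddMonoidHom.mulRight (φ f * d ^ i)))
    (fun g j hj => ?_) hM
  simp only [AddSubgroup.mem_comap, AddMonoidHom.sub_apply, AddMonoidHom.coe_mulLeft,
    AddMonoidHom.mulRight_apply]
  have h1 := opsLT_mono (n := a + b - 2) (by omega) (monomial_commutator_sub_mem_opsLT hd f g i j)
  have h2 : φ (i * (f * δ g) - j * (g * δ f)) * d ^ (i + j - 1) ∈ opsLT φ d (a + b - 2) := by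
    rcases Nat.eq_zero_or_pos (i + j) with h | h
    · obtain ⟨rfl, rfl⟩ : i = 0 ∧ j = 0 := by omega
      simp
    · exact mul_pow_mem_opsLT _ (by omega)
  convert add_mem h1 h2 using 1
  abel

end

/-- `L = f dⁿ + (terms of order < n)`. -/
def HasSymbol (φ : F →+* Q) (d : Q) (L : Q) (n : ℕ) (f : F) : Prop :=
  L - φ f * d ^ n ∈ opsLT φ d n

lemma HasSymbol.mem_opsLT {L : Q} {n : ℕ} {f : F} (h : HasSymbol φ d L n f) :
    L ∈ opsLT φ d (n + 1) := by
  convert add_mem (opsLT_mono (n := (n : ℤ) + 1) (by omega) h)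
    (mul_pow_mem_opsLT f (lt_add_one (n : ℤ))) using 1
  abel

lemma HasSymbol.mul (hd : ∀ f, d * φ f = φ f * d + φ (δ f)) {L M : Q} {n m : ℕ} {f g : F}
    (hL : HasSymbol φ d L n f) (hM : HasSymbol φ d M m g) :
    HasSymbol φ d (L * M) (n + m) (f * g) := by
  have h1 := opsLT_mono (n := (n : ℤ) + m) (by omega) (mul_mem_opsLT hd hL hM.mem_opsLT)
  have h2 := opsLT_mono (n := (n : ℤ) + m) (by omega)
    (mul_mem_opsLT hd (mul_pow_mem_opsLT f (lt_add_one (n : ℤ))) hM)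
  have h3 := coeff_mul_mem_opsLT f (mul_pow_mem_opsLT_add (d_pow_mul_sub_mem_opsLT' hd n g) m)
  unfold HasSymbol
  push_cast
  convert add_mem (add_mem h1 h2) h3 using 1
  rw [map_mul, pow_add]
  noncomm_ring

/-- Only the leading terms matter, the lower ones contributing below degree `n + m - 1`. The new
coefficient may vanish, in which case the conclusion is just a bound on the order. -/
lemma HasSymbol.commutator (hd : ∀ f, d * φ f = φ f * d + φ (δ f)) {L M : Q} {n m : ℕ} {f g : F}
    (hL : HasSymbol φ d L n f) (hM : HasSymbol φ d M m g) (hnm : 0 < n + m) :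
    HasSymbol φ d (L * M - M * L) (n + m - 1) (n * (f * δ g) - m * (g * δ f)) := by
  have h1 := opsLT_mono (n := (n : ℤ) + m - 1) (by omega) (commutator_mem_opsLT hd hL hM.mem_opsLT)
  have h2 := opsLT_mono (n := (n : ℤ) + m - 1) (by omega)
    (commutator_mem_opsLT hd (mul_pow_mem_opsLT f (lt_add_one (n : ℤ))) hM)
  have h3 := monomial_commutator_sub_mem_opsLT hd f g n m
  unfold HasSymbol
  rw [show ((n + m - 1 : ℕ) : ℤ) = n + m - 1 by omega]
  convert add_mem (add_mem h1 h2) h3 using 1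
  noncomm_ring

lemma eval₂_mem_opsLT {n : ℕ} {P : F[X]} (hP : P.degree < n) : P.eval₂ φ d ∈ opsLT φ d n := by
  rw [eval₂_eq_sum]
  refine sum_mem fun i hi => mul_pow_mem_opsLT _ ?_
  exact_mod_cast (le_degree_of_mem_supp i hi).trans_lt hP

/-- Operators become polynomials with coefficients on the left. As `d` does not commute with the
coefficients, `eval₂` is used only as an additive map. -/
lemma mem_opsLT_iff {n : ℕ} {L : Q} :
    L ∈ opsLT φ d n ↔ ∃ P : F[X], P.degree < n ∧ P.eval₂ φ d = L := by
  refine ⟨fun h => ?_, ?_⟩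
  · refine AddSubgroup.closure_induction (p := fun L _ => ∃ P : F[X], P.degree < n ∧
      P.eval₂ φ d = L) ?_ ⟨0, by simp, by simp⟩ ?_ ?_ h
    · rintro _ ⟨f, i, hi, rfl⟩
      exact ⟨monomial i f, (degree_monomial_le _ _).trans_lt (by exact_mod_cast hi), by simp⟩
    · rintro _ _ _ _ ⟨P, hP, rfl⟩ ⟨R, hR, rfl⟩
      exact ⟨P + R, (degree_add_le _ _).trans_lt (max_lt hP hR), by simp⟩
    · rintro _ _ ⟨P, hP, rfl⟩
      refine ⟨-P, by rwa [degree_neg], ?_⟩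
      rw [eq_neg_iff_add_eq_zero, ← eval₂_add]
      simp
  · rintro ⟨P, hP, rfl⟩
    exact eval₂_mem_opsLT hP

lemma hasSymbol_eval₂ {n : ℕ} {P : F[X]} (hP : P.degree < (n + 1 : ℕ)) :
    HasSymbol φ d (P.eval₂ φ d) n (P.coeff n) := by
  have h : (P - monomial n (P.coeff n)).degree < n := by
    rw [degree_lt_iff_coeff_zero] at hP ⊢
    intro m hm
    rw [coeff_sub, coeff_monomial]
    split_ifs with h
    · rw [h, sub_self]
    · rw [hP m (by omega), sub_zero]
  have h1 := eval₂_mem_opsLT (φ := φ) (d := d) h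
  unfold HasSymbol
  convert h1 using 1
  rw [eq_comm, eq_sub_iff_add_eq, ← eval₂_monomial, ← eval₂_add, sub_add_cancel]

lemma exists_eval₂_of_hasSymbol {n : ℕ} {L : Q} {f : F} (h : HasSymbol φ d L n f) :
    ∃ P : F[X], P.degree < (n + 1 : ℕ) ∧ P.coeff n = f ∧ P.eval₂ φ d = L := by
  obtain ⟨P, hP, h'⟩ := mem_opsLT_iff.1 h
  refine ⟨P + monomial n f, (degree_add_le _ _).trans_lt (max_lt (hP.trans (by norm_cast; omega))
    ((degree_monomial_le _ _).trans_lt (by norm_cast; omega))), ?_, ?_⟩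
  · rw [coeff_add, coeff_monomial_same, (degree_lt_iff_coeff_zero _ _).1 hP n le_rfl, zero_add]
  · rw [eval₂_add, h', eval₂_monomial, sub_add_cancel]

/-! ### Bracketing with `x` as differentiation with respect to `d` -/

section

variable {x : Q} (hx : d * x = x * d + 1) (hφx : ∀ f, x * φ f = φ f * x)
include hx

omit [Field F] in
lemma pow_mul_eq_of_bracket (i : ℕ) : d ^ i * x = x * d ^ i + i * d ^ (i - 1) := by
  induction i with
  | zero => simp
  | succ i ih =>
    have h : (i : Q) * (d * d ^ (i - 1)) = i * d ^ i := by
      rcases i with _ | i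
      · simp
      · rw [← pow_succ']; simp
    rw [pow_succ', mul_assoc, ih, mul_add, ← mul_assoc, hx, ← mul_assoc, ← Nat.cast_comm,
      mul_assoc, h]
    simp only [add_mul, Nat.cast_add, Nat.cast_one, one_mul, Nat.add_sub_cancel, mul_assoc]
    abel

include hφx

lemma eval₂_mul_sub_eq_eval₂_derivative (P : F[X]) :
    P.eval₂ φ d * x - x * P.eval₂ φ d = (derivative P).eval₂ φ d := by
  induction P using Polynomial.induction_on' with
  | add p q hp hq => rw [eval₂_add, derivative_add, eval₂_add, ← hp, ← hq]; noncomm_ring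
  | monomial n a =>
    rw [derivative_monomial, eval₂_monomial, eval₂_monomial, mul_assoc, pow_mul_eq_of_bracket hx,
      mul_add, ← mul_assoc, ← hφx, map_mul, map_natCast]
    simp only [mul_assoc]
    abel

/-- A relation `∑ fᵢ dⁱ = 0` can be bracketed with `x`, giving a relation of smaller degree. By
induction its polynomial has zero derivative, so in characteristic zero it is constant. -/
lemma eval₂_injective [CharZero F] : Function.Injective fun P : F[X] => P.eval₂ φ d := by
  have key : ∀ (n : ℕ) (P : F[X]), P.natDegree ≤ n → P.eval₂ φ d = 0 → P = 0 := by
    intro n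
    induction n with
    | zero =>
      intro P hP h
      rw [eq_C_of_natDegree_le_zero hP] at h ⊢
      rw [eval₂_C] at h
      rw [(map_eq_zero φ).1 h, C_0]
    | succ n ih =>
      intro P hP h
      have h1 : (derivative P).eval₂ φ d = 0 := by
        rw [← eval₂_mul_sub_eq_eval₂_derivative hx hφx, h]; simp
      have h2 := ih _ (by have := natDegree_derivative_le P; omega) h1
      have h3 := derivative_eq_zero.1 h2
      rw [eq_C_of_natDegree_eq_zero h3] at h ⊢
      rw [eval₂_C] at h
      rw [(map_eq_zero φ).1 h, C_0]
  intro P R h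
  refine sub_eq_zero.1 (key _ (P - R) le_rfl ?_)
  have h' : P.eval₂ φ d = R.eval₂ φ d := h
  have : (P - R).eval₂ φ d + R.eval₂ φ d = P.eval₂ φ d := by rw [← eval₂_add, sub_add_cancel]
  rw [h'] at this
  exact add_eq_right.1 this

omit hx hφx in
lemma exists_derivative_eq [CharZero F] (P : F[X]) : ∃ R : F[X], derivative R = P := by
  induction P using Polynomial.induction_on' with
  | add p q hp hq =>
    obtain ⟨r, rfl⟩ := hp
    obtain ⟨s, rfl⟩ := hq
    exact ⟨r + s, derivative_add⟩
  | monomial n a =>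
    refine ⟨monomial (n + 1) (a / (n + 1)), ?_⟩
    rw [derivative_monomial]
    congr 1
    have : (n : F) + 1 ≠ 0 := by exact_mod_cast n.succ_ne_zero
    push_cast
    field_simp

lemma HasSymbol.eq_of_hasSymbol [CharZero F] {L : Q} {n : ℕ} {f g : F} (h : HasSymbol φ d L n f)
    (h' : HasSymbol φ d L n g) : f = g := by
  obtain ⟨P, -, rfl, hP⟩ := exists_eval₂_of_hasSymbol h
  obtain ⟨R, -, rfl, hR⟩ := exists_eval₂_of_hasSymbol h'
  rw [eval₂_injective hx hφx (hP.trans hR.symm)]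

end

end Operators

/-! ### Orders of rational functions at a point -/

section Order

variable {k F : Type*} [Field k] [Field F] [Algebra k[X] F]

local notation "ι" => algebraMap k[X] F

/-- `f` has neither a zero nor a pole at `a`. -/
def IsUnitAt (a : k) (f : F) : Prop :=
  ∃ p q : k[X], p.eval a ≠ 0 ∧ q.eval a ≠ 0 ∧ f = ι p / ι q

/-- `f` has no pole at `a`. -/
def IsRegularAt (a : k) (f : F) : Prop :=
  ∃ p q : k[X], q.eval a ≠ 0 ∧ f = ι p / ι q

/-- `f` has order `r` at `a`. -/
def HasOrderAt (a : k) (f : F) (r : ℤ) : Prop :=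
  ∃ u, IsUnitAt a u ∧ f = ι (X - C a) ^ r * u

variable {a : k} {f g : F} {r s : ℤ}

lemma IsUnitAt.isRegularAt (h : IsUnitAt a f) : IsRegularAt a f := by
  obtain ⟨p, q, hp, hq, rfl⟩ := h
  exact ⟨p, q, hq, rfl⟩

lemma IsUnitAt.mul (hf : IsUnitAt a f) (hg : IsUnitAt a g) : IsUnitAt a (f * g) := by
  obtain ⟨p, q, hp, hq, rfl⟩ := hf
  obtain ⟨p', q', hp', hq', rfl⟩ := hg
  exact ⟨p * p', q * q', by simp [hp, hp'], by simp [hq, hq'], by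
    rw [map_mul, map_mul, div_mul_div_comm]⟩

lemma IsUnitAt.inv (hf : IsUnitAt a f) : IsUnitAt a f⁻¹ := by
  obtain ⟨p, q, hp, hq, rfl⟩ := hf
  exact ⟨q, p, hq, hp, inv_div _ _⟩

lemma isUnitAt_intCast [CharZero k] {n : ℤ} (hn : n ≠ 0) : IsUnitAt a (n : F) :=
  ⟨(n : k[X]), 1, by simpa using hn, by simp, by simp⟩

lemma isRegularAt_intCast (n : ℤ) : IsRegularAt a (n : F) :=
  ⟨(n : k[X]), 1, by simp, by simp⟩

lemma IsRegularAt.mul (hf : IsRegularAt a f) (hg : IsRegularAt a g) : IsRegularAt a (f * g) := by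
  obtain ⟨p, q, hq, rfl⟩ := hf
  obtain ⟨p', q', hq', rfl⟩ := hg
  exact ⟨p * p', q * q', by simp [hq, hq'], by rw [map_mul, map_mul, div_mul_div_comm]⟩

lemma hasOrderAt_X_sub_C (a : k) : HasOrderAt a (ι (X - C a)) 1 :=
  ⟨1, ⟨1, 1, by simp, by simp, by simp⟩, by simp⟩

lemma hasOrderAt_algebraMap {p : k[X]} (hp : p ≠ 0) (a : k) :
    HasOrderAt a (ι p) (p.rootMultiplicity a) := by
  obtain ⟨q, hq, hq'⟩ := exists_eq_pow_rootMultiplicity_mul_and_not_dvd p hp a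
  refine ⟨ι q, ⟨q, 1, ?_, by simp, by simp⟩, ?_⟩
  · rwa [dvd_iff_isRoot] at hq'
  · conv_lhs => rw [hq]
    simp

lemma HasOrderAt.inv (hf : HasOrderAt a f r) : HasOrderAt a f⁻¹ (-r) := by
  obtain ⟨u, hu, rfl⟩ := hf
  exact ⟨u⁻¹, hu.inv, by rw [mul_inv, zpow_neg]⟩

variable [IsFractionRing k[X] F]

lemma algebraMap_poly_ne_zero {p : k[X]} (hp : p ≠ 0) : ι p ≠ 0 := by
  rwa [Ne, FaithfulSMul.algebraMap_eq_zero_iff]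

lemma algebraMap_ne_zero_of_eval {a : k} {p : k[X]} (hp : p.eval a ≠ 0) : ι p ≠ 0 :=
  algebraMap_poly_ne_zero (by rintro rfl; simp at hp)

lemma algebraMap_X_sub_C_ne_zero (a : k) : ι (X - C a) ≠ 0 :=
  algebraMap_poly_ne_zero (X_sub_C_ne_zero a)

lemma IsUnitAt.ne_zero (h : IsUnitAt a f) : f ≠ 0 := by
  obtain ⟨p, q, hp, hq, rfl⟩ := h
  exact div_ne_zero (algebraMap_ne_zero_of_eval hp) (algebraMap_ne_zero_of_eval hq)

lemma IsRegularAt.sub (hf : IsRegularAt a f) (hg : IsRegularAt a g) : IsRegularAt a (f - g) := by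
  obtain ⟨p, q, hq, rfl⟩ := hf
  obtain ⟨p', q', hq', rfl⟩ := hg
  exact ⟨p * q' - q * p', q * q', by simp [hq, hq'], by
    rw [div_sub_div _ _ (algebraMap_ne_zero_of_eval hq) (algebraMap_ne_zero_of_eval hq')]
    simp⟩

/-- The added term vanishes at `a`, so the value there is unchanged. -/
lemma IsUnitAt.add_mul (hf : IsUnitAt a f) (hg : IsRegularAt a g) :
    IsUnitAt a (f + ι (X - C a) * g) := by
  obtain ⟨p, q, hp, hq, rfl⟩ := hf
  obtain ⟨p', q', hq', rfl⟩ := hg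
  refine ⟨p * q' + q * ((X - C a) * p'), q * q', by simp [hp, hq'], by simp [hq, hq'], ?_⟩
  rw [← mul_div_assoc, div_add_div _ _ (algebraMap_ne_zero_of_eval hq)
    (algebraMap_ne_zero_of_eval hq')]
  simp only [map_mul, map_add]

lemma HasOrderAt.ne_zero (h : HasOrderAt a f r) : f ≠ 0 := by
  obtain ⟨u, hu, rfl⟩ := h
  exact mul_ne_zero (zpow_ne_zero _ (algebraMap_X_sub_C_ne_zero a)) hu.ne_zero

lemma HasOrderAt.mul (hf : HasOrderAt a f r) (hg : HasOrderAt a g s) :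
    HasOrderAt a (f * g) (r + s) := by
  obtain ⟨u, hu, rfl⟩ := hf
  obtain ⟨v, hv, rfl⟩ := hg
  refine ⟨u * v, hu.mul hv, ?_⟩
  rw [zpow_add₀ (algebraMap_X_sub_C_ne_zero a)]
  ring

lemma exists_eq_div_isRelPrime (f : F) :
    ∃ p q : k[X], q ≠ 0 ∧ IsRelPrime p q ∧ f = ι p / ι q :=
  ⟨IsFractionRing.num k[X] f, IsFractionRing.den k[X] f,
    nonZeroDivisors.ne_zero (IsFractionRing.den k[X] f).2, IsFractionRing.num_den_reduced k[X] f, by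
    rw [← IsFractionRing.mk'_eq_div, IsFractionRing.mk'_num_den]⟩

lemma exists_hasOrderAt (hf : f ≠ 0) (a : k) : ∃ r, HasOrderAt a f r := by
  obtain ⟨p, q, hq, -, rfl⟩ := exists_eq_div_isRelPrime (k := k) f
  have hp : p ≠ 0 := by rintro rfl; simp at hf
  have h := (hasOrderAt_algebraMap (F := F) hp a).mul (hasOrderAt_algebraMap hq a).inv
  rw [← div_eq_mul_inv] at h
  exact ⟨_, h⟩

/-- A rational function of non-negative order at each point is a polynomial. -/
lemma exists_eq_algebraMap_of_order_nonneg [IsAlgClosed k]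
    (h : ∀ a : k, ∃ r, 0 ≤ r ∧ HasOrderAt a f r) : ∃ p, f = ι p := by
  obtain ⟨p, q, hq, hpq, rfl⟩ := exists_eq_div_isRelPrime (k := k) f
  -- A root of the reduced denominator would, by non-negativity of the order, also be a root of the
  -- numerator.
  have hd : IsUnit q := by
    by_contra hd
    obtain ⟨a, ha⟩ := IsAlgClosed.exists_root q
      (fun h => hd (isUnit_iff_degree_eq_zero.2 h))
    obtain ⟨r, hr, u, ⟨p', q', hp', hq', rfl⟩, hf⟩ := h a
    lift r to ℕ using hr
    rw [zpow_natCast, ← mul_div_assoc, div_eq_div_iff (algebraMap_poly_ne_zero hq)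
      (algebraMap_ne_zero_of_eval hq')] at hf
    have h2 : p * q' = (X - C a) ^ r * p' * q :=
      IsFractionRing.injective k[X] F (by simpa using hf)
    have h3 := congrArg (eval a) h2
    rw [eval_mul, eval_mul (p := _ * p'), ha.eq_zero, mul_zero] at h3
    have h4 := (mul_eq_zero.1 h3).resolve_right hq'
    exact not_isUnit_X_sub_C a (hpq (dvd_iff_isRoot.2 h4) (dvd_iff_isRoot.2 ha))
  obtain ⟨v, hv⟩ := hd
  refine ⟨p * (↑v⁻¹ : k[X]), ?_⟩
  rw [div_eq_iff (algebraMap_poly_ne_zero hq), ← map_mul, ← hv, mul_assoc, Units.inv_mul, mul_one]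

/-! ### Orders and derivatives -/

section

variable {δ : Derivation ℤ F F} (hδ : ∀ p : k[X], δ (algebraMap k[X] F p) = algebraMap k[X] F (derivative p))
include hδ

lemma IsRegularAt.derivation (hf : IsRegularAt a f) : IsRegularAt a (δ f) := by
  obtain ⟨p, q, hq, rfl⟩ := hf
  refine ⟨derivative p * q - p * derivative q, q * q, by simp [hq], ?_⟩
  have := algebraMap_ne_zero_of_eval (F := F) hq
  rw [div_eq_mul_inv, δ.leibniz, δ.leibniz_inv, hδ, hδ]
  simp only [smul_eq_mul, map_sub, map_mul]
  field_simp
  ring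

/-- The order of the coefficient of a commutator. -/
lemma HasOrderAt.bracket [CharZero k] (hf : HasOrderAt a f r) (hg : HasOrderAt a g s) {m n : ℕ}
    (h : (m : ℤ) * r - n * s ≠ 0) : HasOrderAt a (m * (g * δ f) - n * (f * δ g)) (r + s - 1) := by
  obtain ⟨u, hu, rfl⟩ := hf
  obtain ⟨v, hv, rfl⟩ := hg
  have ht := algebraMap_X_sub_C_ne_zero (F := F) a
  -- With `t = X - a`, `f = t ^ r u` and `g = t ^ s v`, factoring out `t ^ (r + s - 1)` leaves `(m r
  -- - n s) u v + t (m v u' - n u v')`, which is nonzero at `a` because `m r - n s ≠ 0`.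
  refine ⟨((m : ℤ) * r - n * s : ℤ) * (u * v) + ι (X - C a) * ((m : ℤ) * (v * δ u)
    - (n : ℤ) * (u * δ v)), ((isUnitAt_intCast h).mul (hu.mul hv)).add_mul
      (((isRegularAt_intCast _).mul (hv.isRegularAt.mul (hu.isRegularAt.derivation hδ))).sub
        ((isRegularAt_intCast _).mul (hu.isRegularAt.mul (hv.isRegularAt.derivation hδ)))), ?_⟩
  have h1 : δ (ι (X - C a)) = 1 := by rw [hδ]; simp
  generalize ι (X - C a) = t at ht h1 ⊢
  simp only [δ.leibniz, δ.leibniz_zpow, h1, smul_eq_mul, zsmul_eq_mul, zpow_sub_one₀ ht,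
    zpow_add₀ ht, mul_one]
  push_cast
  field_simp
  ring

end

end Order

/-! ### The field `ℂ(x)` inside a division ring -/

section RatField

variable {Q : Type*} [DivisionRing Q] [Algebra ℂ Q] {x d : Q}

lemma mul_aeval_eq_of_bracket (hx : d * x = x * d + 1) (p : ℂ[X]) :
    d * aeval x p = aeval x p * d + aeval x (derivative p) := by
  have h1 : ∀ n : ℕ, d * x ^ (n + 1) = x ^ (n + 1) * d + (n + 1 : ℕ) * x ^ n := by
    intro n
    induction n with
    | zero => simpa using hx
    | succ n ih =>
      rw [pow_succ _ (n + 1), ← mul_assoc, ih, add_mul, mul_assoc _ d, hx, mul_add, mul_assoc _ _ x,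
        ← pow_succ]
      push_cast
      simp only [mul_one, add_mul, one_mul, ← mul_assoc]
      abel
  induction p using Polynomial.induction_on' with
  | add p q hp hq => simp only [map_add, mul_add, add_mul, hp, hq]; abel
  | monomial n a =>
    rcases n with _ | n
    · simp only [monomial_zero_left, aeval_C, derivative_C, map_zero, add_zero]
      exact (Algebra.commutes a d).symm
    · rw [derivative_monomial, aeval_monomial, aeval_monomial, ← mul_assoc,
        ← Algebra.commutes a d, mul_assoc, h1, map_mul, map_natCast]
      simp only [Nat.add_sub_cancel, mul_add, mul_assoc]

/-- Bracketing with `d` turns an algebraic relation for `x` into its derivative, so no nontrivial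
relation of least degree exists. -/
lemma aeval_injective_of_bracket (hx : d * x = x * d + 1) :
    Function.Injective (aeval x : ℂ[X] →ₐ[ℂ] Q) := by
  rw [injective_iff_map_eq_zero]
  have key : ∀ (n : ℕ) (p : ℂ[X]), p.natDegree ≤ n → aeval x p = 0 → p = 0 := by
    intro n
    induction n with
    | zero =>
      intro p hp h
      rw [eq_C_of_natDegree_le_zero hp] at h ⊢
      rw [aeval_C, map_eq_zero] at h
      rw [h, C_0]
    | succ n ih =>
      intro p hp h
      have h1 := mul_aeval_eq_of_bracket hx p
      rw [h, mul_zero, zero_mul, zero_add] at h1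
      have h2 := ih _ (by have := natDegree_derivative_le p; omega) h1.symm
      rw [eq_C_of_natDegree_eq_zero (derivative_eq_zero.1 h2)] at h ⊢
      rw [aeval_C, map_eq_zero] at h
      rw [h, C_0]
  exact fun p => key _ p le_rfl

lemma mem_polyRing {y : Q} : y ∈ polyRing x ↔ ∃ p : ℂ[X], aeval x p = y := by
  rw [polyRing, Algebra.adjoin_singleton_eq_range_aeval, AlgHom.mem_range]

omit [Algebra ℂ Q] in
/-- Subfields generated by commuting elements are commutative. -/
lemma mul_comm_of_mem_closure {S : Set Q} (hS : ∀ s ∈ S, ∀ t ∈ S, s * t = t * s) {a b : Q}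
    (ha : a ∈ Subfield.closure S) (hb : b ∈ Subfield.closure S) : a * b = b * a := by
  -- Two passes: the closure commutes with `S`, hence `S`, and then the closure, commutes with the
  -- closure.
  have h1 : Subfield.closure S ≤ centralizerSubfield S := Subfield.closure_le.2 fun t ht =>
    mem_centralizerSubfield.2 fun s hs => hS s hs t ht
  have h2 : Subfield.closure S ≤ centralizerSubfield (Subfield.closure S : Set Q) :=
    Subfield.closure_le.2 fun t ht => mem_centralizerSubfield.2 fun s hs =>
      (mem_centralizerSubfield.1 (h1 hs) t ht).symm
  exact mem_centralizerSubfield.1 (h2 hb) a ha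

lemma mul_comm_of_mem_ratField {a b : Q} (ha : a ∈ ratField x) (hb : b ∈ ratField x) :
    a * b = b * a := by
  refine mul_comm_of_mem_closure (fun s hs t ht => ?_) ha hb
  obtain ⟨p, rfl⟩ := mem_polyRing.1 hs
  obtain ⟨q, rfl⟩ := mem_polyRing.1 ht
  rw [← map_mul, ← map_mul, mul_comm]

variable {F : Type*} [Field F] [Algebra ℂ[X] F] [IsFractionRing ℂ[X] F]

variable (F) in
/-- `ℂ(x)` is a copy of the field of rational functions. -/
lemma exists_hom_fieldRange_eq_ratField (hx : d * x = x * d + 1) : ∃ φ : F →+* Q,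
    (∀ p : ℂ[X], φ (algebraMap _ _ p) = aeval x p) ∧ φ.fieldRange = ratField x := by
  let K : Subfield Q := ratField x
  let _ : Field K := { (inferInstance : DivisionRing K) with
    mul_comm := fun a b => Subtype.ext (mul_comm_of_mem_ratField a.2 b.2) }
  have hmem : ∀ p : ℂ[X], aeval x p ∈ K := fun p =>
    Subfield.subset_closure (mem_polyRing.2 ⟨p, rfl⟩)
  let ψ : ℂ[X] →+* K := (aeval x : ℂ[X] →ₐ[ℂ] Q).toRingHom.codRestrict K hmem
  have hψ : Function.Injective ψ := fun p q h =>
    aeval_injective_of_bracket hx (congrArg Subtype.val h)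
  let φ : F →+* Q := K.subtype.comp (IsFractionRing.lift hψ)
  have hφ : ∀ p : ℂ[X], φ (algebraMap _ _ p) = aeval x p := fun p => by
    change ((IsFractionRing.lift hψ (algebraMap _ _ p) : K) : Q) = _
    rw [IsFractionRing.lift_algebraMap]
    rfl
  refine ⟨φ, hφ, le_antisymm ?_ ?_⟩
  · rintro _ ⟨f, rfl⟩
    exact (IsFractionRing.lift hψ f : K).2
  · refine Subfield.closure_le.2 fun y hy => ?_
    obtain ⟨p, rfl⟩ := mem_polyRing.1 hy
    exact ⟨_, hφ p⟩

omit [IsFractionRing ℂ[X] F] in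
/-- The derivation of `ℂ(x)` induced by the commutator with `d`. -/
lemma exists_derivation (hx : d * x = x * d + 1) {φ : F →+* Q}
    (hφ : ∀ p : ℂ[X], φ (algebraMap _ _ p) = aeval x p) (hφ' : φ.fieldRange = ratField x) :
    ∃ δ : Derivation ℤ F F,
      (∀ p : ℂ[X], δ (algebraMap _ _ p) = algebraMap _ _ (derivative p)) ∧
      ∀ f, d * φ f = φ f * d + φ (δ f) := by
  have h : ∀ f, ∃ g, φ g = d * φ f - φ f * d := by
    intro f
    have h1 : φ f * d - d * φ f ∈ (ratField x).toSubring.toAddSubgroup := by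
      -- The bimodule is `ℂ(x)` itself, so it is enough to check generators, where the commutator is
      -- minus the derivative.
      refine commutator_mem_of_mem_closure (S := (polyRing x : Set Q)) _
        (fun a ha b hb => (ratField x).mul_mem ha hb) (fun a ha b hb => (ratField x).mul_mem hb ha)
        (fun c hc => ?_) ?_
      · obtain ⟨p, rfl⟩ := mem_polyRing.1 hc
        rw [mul_aeval_eq_of_bracket hx]
        refine Subfield.subset_closure (mem_polyRing.2 ⟨-derivative p, ?_⟩)
        rw [map_neg]
        abel
      · change φ f ∈ ratField x
        rw [← hφ']
        exact ⟨f, rfl⟩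
    have h2 : φ f * d - d * φ f ∈ φ.fieldRange := by rw [hφ']; exact h1
    obtain ⟨g, hg⟩ := h2
    exact ⟨-g, by rw [map_neg, hg]; abel⟩
  choose δ hδ using h
  let δ' : F →+ F := AddMonoidHom.mk' δ fun f g => φ.injective (by
    rw [map_add, hδ, hδ, hδ, map_add]; noncomm_ring)
  refine ⟨Derivation.mk' δ'.toIntLinearMap fun f g => φ.injective ?_, fun p => φ.injective ?_,
    fun f => ?_⟩
  · change φ (δ (f * g)) = φ (f * δ g + g * δ f)
    rw [mul_comm g, map_add, map_mul, map_mul, hδ, hδ, hδ, map_mul]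
    noncomm_ring
  · change φ (δ _) = _
    rw [hδ, hφ, hφ, mul_aeval_eq_of_bracket hx]
    abel
  · change _ = _ + φ (δ f)
    rw [hδ]
    abel

end RatField

/-! ### Mad subalgebras -/

section MadSubalgebras

namespace IsMad

variable {A : Type*} [Ring A] [Algebra ℂ A] {B B' : Subalgebra ℂ A}

/-- Induction along the `ad`-nilpotent action of a mad subalgebra. -/
lemma induction (hB : IsMad B) {P : A → Prop} (h0 : P 0)
    (hs : ∀ a, (∀ b ∈ B, P (b * a - a * b)) → P a) (a : A) : P a := by
  have key : ∀ (k : ℕ) (a : A), (∀ l : List A, l.length = k → (∀ b ∈ l, b ∈ B) →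
      l.foldr (fun b c => ⁅b, c⁆) a = 0) → P a := by
    intro k
    induction k with
    | zero =>
      intro a ha
      have : a = 0 := ha [] rfl (by simp)
      exact this ▸ h0
    | succ k ih =>
      refine fun a ha => hs a fun b hb => ih _ fun l hl hlB => ?_
      -- `foldr` applies the last entry first, so appending `b` replaces `a` by `[b, a]`.
      have := ha (l ++ [b]) (by simp [hl]) (by
        intro c hc
        rcases List.mem_append.1 hc with h | h
        · exact hlB c h
        · rwa [List.mem_singleton.1 h])
      simpa [Ring.lie_def] using this
  obtain ⟨k, hk⟩ := Set.mem_iUnion.1 (hB.adNilpotent ▸ Set.mem_univ a)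
  exact key (k + 1) a hk

lemma mem_of_forall_commute (hB : IsMad B) {a : A} (h : ∀ b ∈ B, b * a = a * b) : a ∈ B := by
  rw [← hB.centralizer_eq, Subalgebra.mem_centralizer_iff]
  exact h

lemma mul_comm (hB : IsMad B) {a b : A} (ha : a ∈ B) (hb : b ∈ B) : a * b = b * a := by
  rw [← hB.centralizer_eq, Subalgebra.mem_centralizer_iff] at hb
  exact hb a ha

/-- Mad subalgebras are maximal commutative, so two that commute with each other coincide. -/
lemma eq_of_forall_commute (hB : IsMad B) (hB' : IsMad B')
    (h : ∀ b' ∈ B', ∀ b ∈ B, b * b' = b' * b) : B' = B := by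
  have h1 : B' ≤ B := fun b' hb' => hB.mem_of_forall_commute (h b' hb')
  exact le_antisymm h1 fun b hb => hB'.mem_of_forall_commute fun b' hb' =>
    hB.mul_comm (h1 hb') hb

end IsMad

variable {Q : Type*} [DivisionRing Q] [Algebra ℂ Q] {D : Subalgebra ℂ Q} {B B' : Subalgebra ℂ D}
  {x d : Q}

lemma coe_mem_fracField {b : D} (hb : b ∈ B) : (b : Q) ∈ fracField (B.map D.val) :=
  Subfield.subset_closure ⟨b, hb, rfl⟩

/-- The centralizer of a mad subalgebra in the quotient field is its field of fractions. -/
lemma IsMad.mem_fracField_of_forall_commute (hB : IsMad B) (hquot : IsQuotientFieldOf D) {q : Q}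
    (hq : ∀ b ∈ B, (b : Q) * q = q * b) : q ∈ fracField (B.map D.val) := by
  -- Write `q = c a⁻¹`. Since `q` commutes with `b ∈ B`, the pair `([b, a], [b, c])` represents `q`
  -- as well whenever `[b, a] ≠ 0`. The process ends at a nonzero denominator commuting with `B`;
  -- then numerator and denominator both lie in `B`.
  have key : ∀ a : D, a ≠ 0 → ∀ c : D, (c : Q) = q * a → q ∈ fracField (B.map D.val) := by
    refine hB.induction (fun h => absurd rfl h) fun a ih ha c hc => ?_
    by_cases hcomm : ∀ b ∈ B, b * a = a * b
    · have haB := hB.mem_of_forall_commute hcomm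
      have hcB : c ∈ B := hB.mem_of_forall_commute fun b hb => Subtype.ext (by
        have := congrArg Subtype.val (hcomm b hb)
        simp only [Subalgebra.coe_mul] at this ⊢
        rw [hc, ← mul_assoc, hq b hb, mul_assoc, this, mul_assoc])
      have ha' : (a : Q) ≠ 0 := fun h => ha (Subtype.ext h)
      rw [show q = c * (a : Q)⁻¹ by rw [hc, mul_assoc, mul_inv_cancel₀ ha', mul_one]]
      exact Subfield.mul_mem _ (coe_mem_fracField hcB)
        (Subfield.inv_mem _ (coe_mem_fracField haB))
    · push Not at hcomm
      obtain ⟨b, hb, hne⟩ := hcomm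
      refine ih b hb (sub_ne_zero.2 hne) (b * c - c * b) ?_
      push_cast
      rw [hc, ← mul_assoc, hq b hb]
      noncomm_ring
  obtain ⟨a, ha, c, hc, ha0, rfl⟩ := hquot q
  exact key ⟨a, ha⟩ (fun h => ha0 (congrArg Subtype.val h)) ⟨c, hc⟩ (by
    rw [mul_assoc, inv_mul_cancel₀ ha0, mul_one])

namespace IsFatFraming

variable {B₀ : Subalgebra ℂ Q}

lemma mul_eq (hx : IsFatFraming B₀ x d) : d * x = x * d + 1 := by
  have := hx.bracket_eq
  rw [Ring.lie_def] at this
  rw [← this]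
  abel

lemma le_polyRing (hx : IsFatFraming B₀ x d) : B₀ ≤ polyRing x := by
  intro b hb
  rw [← SetLike.mem_coe, ← hx.integralClosure_eq]
  refine ⟨Subfield.subset_closure hb, X - C b, monic_X_sub_C b, fun i => ?_, by simp⟩
  rw [coeff_sub, coeff_X, coeff_C]
  refine B₀.sub_mem ?_ ?_ <;> split_ifs
  exacts [B₀.one_mem, B₀.zero_mem, hb, B₀.zero_mem]

/-- `B₀ ⊆ ℂ[x] ⊆ Frac B₀`, because `ℂ[x]` is the integral closure. -/
lemma fracField_eq (hx : IsFatFraming B₀ x d) : fracField B₀ = ratField x := by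
  refine le_antisymm (Subfield.closure_mono hx.le_polyRing) (Subfield.closure_le.2 ?_)
  rw [← hx.integralClosure_eq]
  exact fun f hf => hf.1

/-- If `B₀` consisted of constants, its field of fractions would commute with `d`; but that field
contains `x`. -/
lemma exists_aeval_mem (hx : IsFatFraming B₀ x d) :
    ∃ p : ℂ[X], 0 < p.natDegree ∧ aeval x p ∈ B₀ := by
  by_contra! hcon
  have h1 : fracField B₀ ≤ centralizerSubfield {d} := by
    refine Subfield.closure_le.2 fun b hb => ?_
    obtain ⟨p, rfl⟩ := mem_polyRing.1 (hx.le_polyRing hb)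
    have hp : p.natDegree = 0 := by
      by_contra h
      exact hcon p (Nat.pos_of_ne_zero h) hb
    rw [eq_C_of_natDegree_eq_zero hp, aeval_C]
    refine mem_centralizerSubfield.2 fun s _ => (Algebra.commutes _ s).symm
  rw [hx.fracField_eq] at h1
  have h2 := mem_centralizerSubfield.1
    (h1 (Subfield.subset_closure (Algebra.self_mem_adjoin_singleton ℂ x))) d rfl
  have h3 := hx.mul_eq
  rw [h2] at h3
  exact one_ne_zero (add_eq_left.1 h3.symm)

end IsFatFraming

/-! ### Finite order of the elements of `D`, and weights of their symbols -/

section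

variable {F : Type*} [Field F] [CharZero F] [Algebra ℂ[X] F] {φ : F →+* Q} {δ : Derivation ℤ F F}

/-- The operators of finite order. -/
def finiteOrderOps (φ : F →+* Q) (d : Q) : AddSubgroup Q where
  carrier := {L | ∃ n : ℤ, L ∈ opsLT φ d n}
  zero_mem' := ⟨0, zero_mem _⟩
  add_mem' := by
    rintro a b ⟨n, hn⟩ ⟨m, hm⟩
    exact ⟨max n m, add_mem (opsLT_mono (le_max_left _ _) hn) (opsLT_mono (le_max_right _ _) hm)⟩
  neg_mem' := by
    rintro a ⟨n, hn⟩
    exact ⟨n, neg_mem hn⟩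

omit [CharZero F] [Algebra ℂ[X] F] [Algebra ℂ Q] in
lemma mem_finiteOrderOps {L : Q} : L ∈ finiteOrderOps φ d ↔ ∃ P : F[X], P.eval₂ φ d = L := by
  refine ⟨?_, ?_⟩
  · rintro ⟨n, hn⟩
    obtain ⟨P, -, hP⟩ := mem_opsLT_iff.1 (opsLT_mono (n := (n.toNat : ℤ)) (by omega) hn)
    exact ⟨P, hP⟩
  · rintro ⟨P, rfl⟩
    exact ⟨(P.natDegree + 1 : ℕ), eval₂_mem_opsLT
      (degree_le_natDegree.trans_lt (by exact_mod_cast Nat.lt_succ_self _))⟩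

variable (hx : IsFatFraming (B.map D.val) x d)
  (hφ : ∀ p : ℂ[X], φ (algebraMap ℂ[X] F p) = aeval x p) (hφr : φ.fieldRange = ratField x)
  (hd : ∀ f, d * φ f = φ f * d + φ (δ f))

omit [CharZero F] [Algebra ℂ[X] F] in
include hφr in
lemma mul_comm_of_fieldRange_eq (f : F) : x * φ f = φ f * x :=
  mul_comm_of_mem_ratField (Subfield.subset_closure (Algebra.self_mem_adjoin_singleton ℂ x))
    (hφr ▸ ⟨f, rfl⟩)

include hx hφr hd in
omit [Algebra ℂ[X] F] in
/-- `D` consists of differential operators. -/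
lemma IsMad.mem_finiteOrderOps (hB : IsMad B) (hquot : IsQuotientFieldOf D) (L : D) :
    (L : Q) ∈ finiteOrderOps φ d := by
  have hl : ∀ k ∈ ratField x, ∀ r ∈ finiteOrderOps φ d, k * r ∈ finiteOrderOps φ d := by
    rw [← hφr]
    rintro _ ⟨f, rfl⟩ r ⟨n, hn⟩
    exact ⟨n, coeff_mul_mem_opsLT f hn⟩
  have hφmem : ∀ f, φ f ∈ opsLT φ d 1 := fun f => by
    simpa using mul_pow_mem_opsLT (φ := φ) (d := d) (n := 1) f (i := 0) (by simp)
  have hr : ∀ k ∈ ratField x, ∀ r ∈ finiteOrderOps φ d, r * k ∈ finiteOrderOps φ d := by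
    rw [← hφr]
    rintro _ ⟨f, rfl⟩ r ⟨n, hn⟩
    exact ⟨_, mul_mem_opsLT hd hn (hφmem f)⟩
  have hfrac : Subfield.closure ((B.map D.val : Subalgebra ℂ Q) : Set Q) = ratField x :=
    hx.fracField_eq
  refine hB.induction (P := fun L => (L : Q) ∈ finiteOrderOps φ d) (zero_mem _) (fun L ih => ?_) L
  -- The hypothesis covers only `b ∈ B`, and `x` need not lie in `B`; it does lie in the field
  -- generated by `B`.
  have h1 : x * (L : Q) - L * x ∈ finiteOrderOps φ d := by
    refine commutator_mem_of_mem_closure (S := ((B.map D.val : Subalgebra ℂ Q) : Set Q)) _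
      (by rwa [hfrac]) (by rwa [hfrac]) ?_ ?_
    · rintro _ ⟨b, hb, rfl⟩
      exact ih b hb
    · rw [hfrac]
      exact Subfield.subset_closure (Algebra.self_mem_adjoin_singleton ℂ x)
  obtain ⟨P, hP⟩ := _root_.mem_finiteOrderOps.1 h1
  -- Integrating `[x, L]` gives `R` with `[R, x] = [x, L]`, so that `L + R` commutes with `x`.
  obtain ⟨R, rfl⟩ := exists_derivative_eq P
  rw [← eval₂_mul_sub_eq_eval₂_derivative hx.mul_eq (mul_comm_of_fieldRange_eq hφr)] at hP
  have h2 : ratField x ≤ centralizerSubfield {(L : Q) + R.eval₂ φ d} := by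
    refine Subfield.closure_le.2 fun y hy => ?_
    obtain ⟨p, rfl⟩ := mem_polyRing.1 hy
    refine mem_centralizerSubfield.2 ?_
    rintro _ rfl
    have h3 : Commute ((L : Q) + R.eval₂ φ d) x := by
      rw [commute_iff_eq, add_mul, mul_add, ← sub_eq_zero]
      rw [← sub_eq_zero] at hP
      rw [← hP]
      abel
    induction p using Polynomial.induction_on' with
    | add p q hp hq =>
      rw [map_add, mul_add, hp (mem_polyRing.2 ⟨p, rfl⟩), hq (mem_polyRing.2 ⟨q, rfl⟩), add_mul]
    | monomial n a =>
      rw [aeval_monomial]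
      have h4 : Commute ((L : Q) + R.eval₂ φ d) (algebraMap ℂ Q a) := (Algebra.commutes a _).symm
      exact h4.mul_right (h3.pow_right n)
  have h4 : (L : Q) + R.eval₂ φ d ∈ fracField (B.map D.val) :=
    hB.mem_fracField_of_forall_commute hquot fun b hb =>
      (mem_centralizerSubfield.1 (h2 (hx.fracField_eq ▸ coe_mem_fracField hb)) _ rfl).symm
  rw [hx.fracField_eq, ← hφr] at h4
  obtain ⟨f, hf⟩ := h4
  have h5 := sub_mem (show φ f ∈ finiteOrderOps φ d from ⟨1, hφmem f⟩)
    (_root_.mem_finiteOrderOps.2 ⟨R, rfl⟩ : R.eval₂ φ d ∈ finiteOrderOps φ d)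
  rwa [hf, add_sub_cancel_right] at h5

variable [IsFractionRing ℂ[X] F]
  (hδ : ∀ p : ℂ[X], δ (algebraMap ℂ[X] F p) = algebraMap ℂ[X] F (derivative p))

include hx hφr hd hδ in
/-- An `ad`-nilpotent element of positive order constrains the order of vanishing of the leading
coefficients of the elements of `D`. -/
lemma IsMad.exists_weight_eq (hB' : IsMad B') {b : D} (hb : b ∈ B') {m : ℕ} {g : F} {a : ℂ} {s : ℤ}
    (hm : 0 < m) (hbg : HasSymbol φ d (b : Q) m g) (hg : HasOrderAt a g s) (L : D) :
    ∀ (n : ℕ) (f : F) (r : ℤ), HasSymbol φ d (L : Q) n f → HasOrderAt a f r →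
      ∃ j : ℕ, (m : ℤ) * r - n * s = j * (m - s) := by
  refine hB'.induction (P := fun L => ∀ (n : ℕ) (f : F) (r : ℤ), HasSymbol φ d (L : Q) n f →
    HasOrderAt a f r → ∃ j : ℕ, (m : ℤ) * r - n * s = j * (m - s)) (fun n f r hf hr => ?_)
    (fun L ih n f r hf hr => ?_) L
  · have h0 : HasSymbol φ d (((0 : D) : Q)) n (0 : F) := by simp [HasSymbol]
    exact absurd (hf.eq_of_hasSymbol hx.mul_eq (mul_comm_of_fieldRange_eq hφr) h0) hr.ne_zero
  -- A nonzero weight keeps the symbol of `[b, L]` nonzero, and `m (r + s - 1) - (n + m - 1) s = (m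
  -- r - n s) - (m - s)`. As the zero operator has no nonzero symbol, the descent can only stop at
  -- weight zero.
  · by_cases hw : (m : ℤ) * r - n * s = 0
    · exact ⟨0, by simpa using hw⟩
    · obtain ⟨j, hj⟩ := ih b hb _ _ _ (hbg.commutator hd hf (by omega)) (hr.bracket hδ hg hw)
      refine ⟨j + 1, ?_⟩
      rw [Nat.cast_sub (by omega)] at hj
      push_cast at hj ⊢
      linarith

omit [CharZero F] [IsFractionRing ℂ[X] F] [Algebra ℂ[X] F] [Algebra ℂ Q] in
lemma exists_hasSymbol {L : Q} (hL : L ∈ finiteOrderOps φ d) (h0 : L ≠ 0) :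
    ∃ (n : ℕ) (f : F), f ≠ 0 ∧ HasSymbol φ d L n f ∧ (n = 0 → L = φ f) := by
  obtain ⟨P, rfl⟩ := mem_finiteOrderOps.1 hL
  refine ⟨P.natDegree, P.coeff P.natDegree, ?_, hasSymbol_eval₂
    (degree_le_natDegree.trans_lt (by exact_mod_cast Nat.lt_succ_self _)), fun h => ?_⟩
  · rw [coeff_natDegree, Ne, leadingCoeff_eq_zero]
    rintro rfl
    simp at h0
  · rw [h]
    conv_lhs => rw [eq_C_of_natDegree_eq_zero h, eval₂_C]

include hx hφ hφr hd hδ in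
/-- The leading coefficients of the elements of `D` are polynomials. -/
lemma IsMad.exists_symbol_eq_algebraMap (hB : IsMad B) (hquot : IsQuotientFieldOf D)
    (hB' : IsMad B') (hne : B' ≠ B) (L : D) {n : ℕ} {f : F} (hf : f ≠ 0)
    (hL : HasSymbol φ d (L : Q) n f) : ∃ p : ℂ[X], f = algebraMap _ _ p := by
  have hmem := hB.mem_finiteOrderOps hx hφr hd hquot
  obtain ⟨b, hb, hbx⟩ : ∃ b ∈ B', (b : Q) ∉ ratField x := by
    by_contra! hcon
    refine hne (hB.eq_of_forall_commute hB' fun b' hb' b hb => Subtype.ext ?_)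
    exact mul_comm_of_mem_ratField (hx.fracField_eq ▸ coe_mem_fracField hb) (hcon b' hb')
  obtain ⟨m, g, hg0, hbg, hm⟩ := exists_hasSymbol (hmem b) fun h => hbx (h ▸ zero_mem _)
  have hm : 0 < m := Nat.pos_of_ne_zero fun h => hbx (by rw [hm h, ← hφr]; exact ⟨g, rfl⟩)
  refine exists_eq_algebraMap_of_order_nonneg fun a => ?_
  obtain ⟨s, hs⟩ := exists_hasOrderAt hg0 a
  have hweight := hB'.exists_weight_eq hx hφr hd hδ hb hm hbg hs
  have hconst : ∀ f : F, HasSymbol φ d (φ f) 0 f := fun f => by simp [HasSymbol]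
  -- Take `c = p(x) ∈ B` nonconstant. Then `c - p(a)` has order zero as an operator and positive
  -- weight, which must equal `j (m - s)` with `j ≥ 0`.
  have hms : s < m := by
    obtain ⟨p, hp, c, hc, hcp⟩ := hx.exists_aeval_mem
    have hp0 : p - C (p.eval a) ≠ 0 := fun h => by
      rw [sub_eq_zero.1 h, natDegree_C] at hp
      exact hp.false
    have hroot : 0 < (p - C (p.eval a)).rootMultiplicity a :=
      (rootMultiplicity_pos hp0).2 (by simp)
    have hsym : HasSymbol φ d ((c - algebraMap ℂ D (p.eval a) : D) : Q) 0
        (algebraMap ℂ[X] F (p - C (p.eval a))) := by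
      convert hconst _ using 1
      rw [hφ, map_sub, aeval_C, ← hcp]
      rfl
    obtain ⟨j, hj⟩ := hweight _ _ _ _ hsym (hasOrderAt_algebraMap hp0 a)
    have : 0 < (m : ℤ) * (p - C (p.eval a)).rootMultiplicity a := by positivity
    by_contra! hle
    have h1 : (j : ℤ) * (m - s) ≤ 0 := mul_nonpos_of_nonneg_of_nonpos (by positivity) (by omega)
    rw [Nat.cast_zero] at hj
    linarith
  -- From `L₂ = (x - a) L₁`, the two symbols have the same degree and their weights differ by
  -- exactly `m`. Both weights are multiples of `m - s`, so `m - s` divides `m` and is at most `m`.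
  have hs0 : 0 ≤ s := by
    obtain ⟨L₁, h₁, L₂, h₂, h0, hq⟩ := hquot (φ (algebraMap ℂ[X] F (X - C a)))
    obtain ⟨n₁, f₁, hf₁, hL₁, -⟩ := exists_hasSymbol (hmem ⟨L₁, h₁⟩) h0
    obtain ⟨r₁, hr₁⟩ := exists_hasOrderAt hf₁ a
    have hL₂ := (hconst (algebraMap ℂ[X] F (X - C a))).mul hd hL₁
    rw [hq, mul_assoc, inv_mul_cancel₀ h0, mul_one] at hL₂
    obtain ⟨i, hi⟩ := hweight _ _ _ _ hL₁ hr₁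
    obtain ⟨j, hj⟩ := hweight ⟨L₂, h₂⟩ _ _ _ hL₂ ((hasOrderAt_X_sub_C a).mul hr₁)
    have h1 : (m : ℤ) - s ∣ m := ⟨j - i, by push_cast at hj; linarith⟩
    have := Int.le_of_dvd (by omega) h1
    omega
  obtain ⟨r, hr⟩ := exists_hasOrderAt hf a
  obtain ⟨j, hj⟩ := hweight L n f r hL hr
  refine ⟨r, ?_, hr⟩
  by_contra! hr0
  have h1 : 0 ≤ (j : ℤ) * (m - s) := mul_nonneg (by positivity) (by omega)
  have h2 : 0 ≤ (n : ℤ) * s := mul_nonneg (by positivity) hs0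
  have h3 : (0 : ℤ) < m := by exact_mod_cast hm
  nlinarith

end

end MadSubalgebras

/-! ### The symbol map -/

section SymbolMap

variable {Q : Type*} [DivisionRing Q] [Algebra ℂ Q] {D : Subalgebra ℂ Q} {x d : Q}

lemma diffOp_eq_eval₂ (f : (ratField x)[X]) : diffOp x d f = f.eval₂ (ratField x).subtype d := by
  rw [eval₂_eq_sum]
  rfl

/-- Operators with coefficients in `ℂ(x)` as operators with coefficients in an isomorphic field. -/
lemma exists_map_diffOp_eq {F : Type*} [Field F] {φ : F →+* Q} (hφr : φ.fieldRange = ratField x)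
    (d : Q) (f : (ratField x)[X]) : ∃ P : F[X], P.degree = f.degree ∧
      (∀ i, φ (P.coeff i) = f.coeff i) ∧ P.eval₂ φ d = diffOp x d f := by
  let e : F →+* ratField x := φ.codRestrict (ratField x) fun y => hφr ▸ ⟨y, rfl⟩
  have he : Function.Surjective e := by
    rintro ⟨y, hy⟩
    obtain ⟨z, hz⟩ : y ∈ φ.fieldRange := hφr ▸ hy
    exact ⟨z, Subtype.ext hz⟩
  obtain ⟨P, rfl⟩ := map_surjective e he f
  refine ⟨P, (degree_map_eq_of_injective e.injective P).symm, fun i => ?_, ?_⟩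
  · rw [coeff_map]
    rfl
  · rw [diffOp_eq_eval₂, eval₂_map]
    rfl

/-- Conversely, operators with coefficients in a field isomorphic to `ℂ(x)` are operators with
coefficients in `ℂ(x)`. -/
lemma exists_diffOp_eq_eval₂ {F : Type*} [Field F] {φ : F →+* Q} (hφr : φ.fieldRange = ratField x)
    (d : Q) (P : F[X]) : ∃ f : (ratField x)[X], f.degree = P.degree ∧
      (∀ i, (f.coeff i : Q) = φ (P.coeff i)) ∧ diffOp x d f = P.eval₂ φ d := by
  let e : F →+* ratField x := φ.codRestrict (ratField x) fun y => hφr ▸ ⟨y, rfl⟩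
  refine ⟨P.map e, degree_map_eq_of_injective e.injective P, fun i => ?_, ?_⟩
  · rw [coeff_map]
    rfl
  · rw [diffOp_eq_eval₂, eval₂_map]
    rfl

/-- The coefficient of order `k` of an operator of order `≤ k`, as a linear map. -/
lemma exists_symbol (hinj : Function.Injective (diffOp x d))
    (hlead : ∀ L ∈ D, ∀ f : (ratField x)[X], diffOp x d f = L →
      (f.leadingCoeff : Q) ∈ polyRing x) (k : ℕ) :
    ∃ s : orderLT D x d (k + 1) →ₗ[ℂ] polyRing x,
      (∀ (L : orderLT D x d (k + 1)) (f : (ratField x)[X]),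
        f.degree < ((k + 1 : ℕ) : WithBot ℕ) → diffOp x d f = L → (s L : Q) = f.coeff k) ∧
      LinearMap.ker s = (orderLT D x d k).submoduleOf (orderLT D x d (k + 1)) := by
  have h : ∀ L : orderLT D x d (k + 1), ∃ c : polyRing x, ∀ f : (ratField x)[X],
      diffOp x d f = L → (c : Q) = f.coeff k := by
    rintro ⟨L, hL, f, hf, rfl⟩
    -- The coefficient in degree `k` is either zero or the leading coefficient.
    have hc : (f.coeff k : Q) ∈ polyRing x := by
      rcases eq_or_ne (f.coeff k) 0 with h | h
      · rw [h]
        exact Subalgebra.zero_mem _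
      · have : f.natDegree = k := by
          refine le_antisymm ?_ (le_natDegree_of_ne_zero h)
          rw [natDegree_le_iff_degree_le]
          exact Order.lt_succ_iff.1 (by exact_mod_cast hf)
        have h2 := hlead _ hL f rfl
        rwa [leadingCoeff, this] at h2
    exact ⟨⟨_, hc⟩, fun g hg => by rw [hinj hg]⟩
  choose c hc using h
  refine ⟨{ toFun := c, map_add' := ?_, map_smul' := ?_ }, fun L f _ hf => hc L f hf, ?_⟩
  · intro L M
    obtain ⟨-, f, -, hf⟩ := L.2
    obtain ⟨-, g, -, hg⟩ := M.2
    refine Subtype.ext ?_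
    rw [hc (L + M) (f + g) (by rw [diffOp_add, hf, hg]; rfl), Subalgebra.coe_add, hc L f hf,
      hc M g hg, coeff_add]
    rfl
  · intro a L
    obtain ⟨-, f, -, hf⟩ := L.2
    refine Subtype.ext ?_
    rw [hc (a • L) _ ((diffOp_C_mul x d a f).trans (by rw [hf]; rfl)), coeff_C_mul,
      RingHom.id_apply, Subalgebra.coe_smul, hc L f hf, Algebra.smul_def]
    rfl
  · ext L
    rw [LinearMap.mem_ker, Submodule.submoduleOf, Submodule.mem_comap]
    obtain ⟨hLD, f, hfk, hf⟩ := L.2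
    change c L = 0 ↔ (L : Q) ∈ orderLT D x d k
    rw [← Subtype.coe_inj, hc L f hf]
    refine ⟨fun h0 => ⟨hLD, f, ?_, hf⟩, ?_⟩
    · rw [degree_lt_iff_coeff_zero] at hfk ⊢
      intro i hi
      rcases hi.eq_or_lt with rfl | hi
      · exact Subtype.ext h0
      · exact hfk i hi
    · rintro ⟨-, g, hgk, hg⟩
      rw [hinj (hf.trans hg.symm), (degree_lt_iff_coeff_zero _ _).1 hgk k le_rfl]
      rfl

/-- If the leading coefficients of the elements of `D` are polynomials, then the symbol map embeds
the associated graded algebra of `D` in a polynomial algebra. -/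
lemma exists_symbolMap (hinj : Function.Injective (diffOp x d))
    (hlead : ∀ L ∈ D, ∀ f : (ratField x)[X], diffOp x d f = L →
      (f.leadingCoeff : Q) ∈ polyRing x)
    (hmul : ∀ (k l : ℕ) (f g : (ratField x)[X]), f.degree < ((k + 1 : ℕ) : WithBot ℕ) →
      g.degree < ((l + 1 : ℕ) : WithBot ℕ) → ∃ h : (ratField x)[X],
        h.degree < ((k + l + 1 : ℕ) : WithBot ℕ) ∧ h.coeff (k + l) = f.coeff k * g.coeff l ∧
        diffOp x d h = diffOp x d f * diffOp x d g) :
    ∃ σ : GrOrder D x d →ₗ[ℂ] (polyRing x)[X],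
      Function.Injective σ ∧
      (∀ (k : ℕ) (L : orderLT D x d (k + 1)) (f : (ratField x)[X]),
        f.degree < ((k + 1 : ℕ) : WithBot ℕ) → diffOp x d f = L →
        ∃ c : polyRing x, (c : Q) = f.coeff k ∧
          σ (grClass D x d k L) = monomial k c) ∧
      (∀ (k l : ℕ) (L : orderLT D x d (k + 1)) (M : orderLT D x d (l + 1)),
        ∃ h : (L : Q) * (M : Q) ∈ orderLT D x d (k + l + 1),
          σ (grClass D x d (k + l) ⟨(L : Q) * (M : Q), h⟩) =
            σ (grClass D x d k L) * σ (grClass D x d l M)) := by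
  choose s hs hker using fun k => exists_symbol hinj hlead k
  let τ : ∀ k : ℕ, (↥(orderLT D x d (k + 1)) ⧸
      (orderLT D x d k).submoduleOf (orderLT D x d (k + 1))) →ₗ[ℂ] polyRing x := fun k =>
    Submodule.liftQ _ (s k) (hker k).ge
  have hτ : ∀ k, Function.Injective (τ k) := fun k =>
    LinearMap.ker_eq_bot.1 (Submodule.ker_liftQ_eq_bot _ _ _ (hker k).le)
  let mon : ∀ k : ℕ, polyRing x →ₗ[ℂ] (polyRing x)[X] := fun k =>
    { toFun := monomial k
      map_add' := fun a b => map_add _ a b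
      map_smul' := fun a b => (smul_monomial a k b).symm }
  let σ : GrOrder D x d →ₗ[ℂ] (polyRing x)[X] :=
    DirectSum.toModule ℂ ℕ _ fun k => mon k ∘ₗ τ k
  have hσ : ∀ (k : ℕ) (L : orderLT D x d (k + 1)), σ (grClass D x d k L) = monomial k (s k L) :=
    fun k L => DirectSum.toModule_lof ℂ k _
  -- Distinct graded pieces land in distinct powers of the variable, so injectivity can be checked
  -- componentwise.
  have hcoeff : ∀ (y : GrOrder D x d) (k : ℕ), (σ y).coeff k = τ k (y k) := by
    intro y k
    induction y using DirectSum.induction_on with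
    | zero => simp
    | of i z =>
      have h1 : σ (DirectSum.lof ℂ ℕ _ i z) = monomial i (τ i z) := DirectSum.toModule_lof ℂ i _
      rw [DirectSum.lof_eq_of] at h1
      rw [h1, coeff_monomial]
      split_ifs with h
      · subst h
        rw [DirectSum.of_eq_same]
      · rw [DirectSum.of_eq_of_ne _ _ _ (Ne.symm h), map_zero]
    | add y z hy hz => rw [map_add, coeff_add, hy, hz, DirectSum.add_apply, map_add]
  refine ⟨σ, fun y z h => ?_, fun k L f hf hL => ⟨s k L, hs k L f hf hL, hσ k L⟩,
    fun k l L M => ?_⟩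
  · refine DFinsupp.ext fun k => hτ k ?_
    rw [← hcoeff, ← hcoeff, h]
  · obtain ⟨hLD, f, hf, hfL⟩ := L.2
    obtain ⟨hMD, g, hg, hgM⟩ := M.2
    obtain ⟨h, hh, hc, hhL⟩ := hmul k l f g hf hg
    have hLM : diffOp x d h = (L : Q) * (M : Q) := by rw [hhL, hfL, hgM]
    refine ⟨⟨D.mul_mem hLD hMD, h, hh, hLM⟩, ?_⟩
    rw [hσ, hσ, hσ, monomial_mul_monomial]
    congr 1
    refine Subtype.ext ?_
    rw [hs _ _ h hh hLM, hc, Subalgebra.coe_mul, hs k L f hf hfL,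
      hs l M g hg hgM]
    rfl

end SymbolMap

/-- The leading coefficients of `D` with respect to a fat framing of a mad subalgebra, and the
associated graded algebra. -/
theorem leadingCoeff_mem_and_exists_symbolMap {Q : Type*} [DivisionRing Q] [Algebra ℂ Q]
    {D : Subalgebra ℂ Q} (hquot : IsQuotientFieldOf D) {B B' : Subalgebra ℂ D} (hB : IsMad B)
    (hB' : IsMad B') (hne : B' ≠ B) {x d : Q} (hx : IsFatFraming (B.map D.val) x d) :
    (∀ L ∈ D, ∃! f : (ratField x)[X], diffOp x d f = L) ∧
    (∀ L ∈ D, ∀ f : (ratField x)[X], diffOp x d f = L → (f.leadingCoeff : Q) ∈ polyRing x) ∧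
    (∃ σ : GrOrder D x d →ₗ[ℂ] (polyRing x)[X],
      Function.Injective σ ∧
      (∀ (k : ℕ) (L : orderLT D x d (k + 1)) (f : (ratField x)[X]),
        f.degree < ((k + 1 : ℕ) : WithBot ℕ) → diffOp x d f = L →
        ∃ c : polyRing x, (c : Q) = f.coeff k ∧
          σ (grClass D x d k L) = monomial k c) ∧
      (∀ (k l : ℕ) (L : orderLT D x d (k + 1)) (M : orderLT D x d (l + 1)),
        ∃ h : (L : Q) * (M : Q) ∈ orderLT D x d (k + l + 1),
          σ (grClass D x d (k + l) ⟨(L : Q) * (M : Q), h⟩) =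
            σ (grClass D x d k L) * σ (grClass D x d l M))) := by
  have : CharZero (FractionRing ℂ[X]) :=
    charZero_of_injective_algebraMap (IsFractionRing.injective ℂ[X] (FractionRing ℂ[X]))
  obtain ⟨φ, hφ, hφr⟩ := exists_hom_fieldRange_eq_ratField (FractionRing ℂ[X]) hx.mul_eq
  obtain ⟨δ, hδ, hd⟩ := exists_derivation hx.mul_eq hφ hφr
  have hinj : Function.Injective (diffOp x d) := by
    intro f g hfg
    obtain ⟨P, -, hP, hP'⟩ := exists_map_diffOp_eq hφr d f
    obtain ⟨R, -, hR, hR'⟩ := exists_map_diffOp_eq hφr d g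
    have h : P = R := eval₂_injective hx.mul_eq (mul_comm_of_fieldRange_eq hφr)
      ((hP'.trans hfg).trans hR'.symm)
    ext i
    rw [← hP, ← hR, h]
  have hlead : ∀ L ∈ D, ∀ f : (ratField x)[X], diffOp x d f = L →
      (f.leadingCoeff : Q) ∈ polyRing x := by
    intro L hL f hf
    rcases eq_or_ne f 0 with rfl | h0
    · simp
    obtain ⟨P, hPdeg, hP, hP'⟩ := exists_map_diffOp_eq hφr d f
    have hsym : HasSymbol φ d L f.natDegree (P.coeff f.natDegree) := by
      rw [← hf, ← hP']
      refine hasSymbol_eval₂ ?_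
      rw [hPdeg]
      exact degree_le_natDegree.trans_lt (by exact_mod_cast Nat.lt_succ_self _)
    have hne0 : P.coeff f.natDegree ≠ 0 := fun h => by
      have := hP f.natDegree
      rw [h, map_zero, coeff_natDegree] at this
      exact h0 (leadingCoeff_eq_zero.1 (Subtype.ext this.symm))
    obtain ⟨p, hp⟩ := hB.exists_symbol_eq_algebraMap hx hφ hφr hd hδ hquot hB' hne ⟨L, hL⟩ hne0 hsym
    rw [leadingCoeff, ← hP, hp, hφ]
    exact mem_polyRing.2 ⟨p, rfl⟩
  refine ⟨fun L hL => ?_, hlead, exists_symbolMap hinj hlead fun k l f g hf hg => ?_⟩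
  · obtain ⟨P, hP⟩ := mem_finiteOrderOps.1 (hB.mem_finiteOrderOps hx hφr hd hquot ⟨L, hL⟩)
    obtain ⟨f, -, -, hf⟩ := exists_diffOp_eq_eval₂ hφr d P
    exact ⟨f, hf.trans hP, fun g hg => hinj (hg.trans (hf.trans hP).symm)⟩
  · obtain ⟨P, hPdeg, hP, hP'⟩ := exists_map_diffOp_eq hφr d f
    obtain ⟨R, hRdeg, hR, hR'⟩ := exists_map_diffOp_eq hφr d g
    -- Multiplicativity of symbols allows zero coefficients, so `k` and `l` need only bound the
    -- orders.
    obtain ⟨S, hS, hS', hS''⟩ := exists_eval₂_of_hasSymbol ((hasSymbol_eval₂ (hPdeg ▸ hf)).mul hd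
      (hasSymbol_eval₂ (φ := φ) (d := d) (hRdeg ▸ hg)))
    obtain ⟨h, hdeg, hh, hh'⟩ := exists_diffOp_eq_eval₂ hφr d S
    refine ⟨h, hdeg ▸ hS, Subtype.ext ?_, by rw [hh', hS'', hP', hR']⟩
    rw [hh, hS', map_mul, hP, hR]
    rfl

theorem theorem4p4
    (D : Subalgebra ℂ WeylField)
    (hquot : IsQuotientFieldOf D)
    (hmany : {B : Subalgebra ℂ D | IsMad B}.Nontrivial)
    (B : Subalgebra ℂ D) (hB : IsMad B)
    (x d : WeylField) (hx : IsFatFraming (B.map D.val) x d) :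
    -- `D` is contained in `ℂ(x)[∂_x]`, and its elements have a unique expansion there
    (∀ L ∈ D, ∃! f : (ratField x)[X], diffOp x d f = L) ∧
    -- the leading coefficient of every element of `D` belongs to `ℂ[x]`
    (∀ L ∈ D, ∀ f : (ratField x)[X], diffOp x d f = L →
      (f.leadingCoeff : WeylField) ∈ polyRing x) ∧
    -- the symbol map embeds the graded algebra `gr_∂ D` in `ℂ[x][ξ]`
    (∃ σ : GrOrder D x d →ₗ[ℂ] (polyRing x)[X],
      Function.Injective σ ∧
      (∀ (k : ℕ) (L : orderLT D x d (k + 1)) (f : (ratField x)[X]),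
        f.degree < ((k + 1 : ℕ) : WithBot ℕ) → diffOp x d f = L →
        ∃ c : polyRing x, (c : WeylField) = f.coeff k ∧
          σ (grClass D x d k L) = monomial k c) ∧
      (∀ (k l : ℕ) (L : orderLT D x d (k + 1)) (M : orderLT D x d (l + 1)),
        ∃ h : (L : WeylField) * (M : WeylField) ∈ orderLT D x d (k + l + 1),
          σ (grClass D x d (k + l) ⟨(L : WeylField) * (M : WeylField), h⟩) =
            σ (grClass D x d k L) * σ (grClass D x d l M))) := by
  obtain ⟨B', hB', hne⟩ := hmany.exists_ne B
  exact leadingCoeff_mem_and_exists_symbolMap hquot hB hB' hne hx
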